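/- Let $a,b\in\mathbb R$, let $\mu$ be a probability measure on $\mathbb R$ carried by $[a,b]$ whose support is infinite, and let $(z_n)_{n\ge 1}$ be complex numbers with $$z_{2j+1}=\overline{z_{2j+2}}\quad (j\ge 0),\qquad \operatorname{dist}(z_n,[a,b])>\delta>0\quad (n\ge 1).$$ For probability measures $\mu_0,\mu_1,\dots$ carried by $[a,b]$ put, for $j\ge 0$, $\varphi_j(z)=\int_a^b\frac{d\mu_j(t)}{z-t}$ and $$B_{j,j}=\frac{\int_a^b \frac{d\mu_j(t)}{|z_{2j+1}-t|^2}}{\left|\int_a^b\frac{d\mu_j(t)}{z_{2j+1}-t}\right|^2},\qquad A_{j,j}=\frac{\int_a^b \frac{t\,d\mu_j(t)}{|z_{2j+1}-t|^2}}{\left|\int_a^b\frac{d\mu_j(t)}{z_{2j+1}-t}\right|^2},$$ $$B_{j+1,j}=B_{j,j+1}=\sqrt{B_{j,j}-1},\qquad A_{j+1,j}=z_{2j+1}B_{j+1,j},\qquad A_{j,j+1}=z_{2j+2}B_{j+1,j},$$ and let all other entries of the infinite matrices $A=(A_{j,k})_{j,k\ge0}$ and $B=(B_{j,k})_{j,k\ge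 0}$ be zero. Call $(\mu_j)_{j\ge0}$ admissible if $\mu_0=\mu$ and, for all $j\ge 0$ and all $z\in\mathbb C\setminus[a,b]$, $$\varphi_j(z)=\frac{1}{zB_{j,j}-A_{j,j}-B_{j+1,j}^2(z-z_{2j+1})(z-z_{2j+2})\varphi_{j+1}(z)}.$$ Then there is an admissible sequence with $B_{j,j}>1$ for all $j\ge 0$. For every admissible sequence, $A$ and $B$ act (by the usual matrix product) as bounded operators on $\ell^2=\ell^2(\{0,1,2,\dots\};\mathbb C)$ with the inner product $\langle x,y\rangle=\sum_j x_j\overline{y_j}$, and the following holds. 1. For all $k\ge 0$ and all $y\in\ell^2$ with $y_0=\dots=y_{k-1}=0$, the number $\langle By,y\rangle$ is real and $\langle By,y\rangle\ge |y_k|^2$. 2. The numerical range $W(A,B)=\{z\in\mathbb C:\ \langle (zB-A)y,y\rangle=0 \text{ for some } y\in\ell^2,\ y\neq 0\}$ of the linear pencil $zB-A$ is contained in $[a,b]$. -/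

import Mathlib

open MeasureTheory

noncomputable section

/-- The Hilbert space of square summable complex sequences `(y₀, y₁, …)`. -/
abbrev SeqL2 : Type := lp (fun _ : ℕ => ℂ) 2

/-- The compact real interval `[a, b]`, viewed as a subset of the complex plane. -/
def complexIcc (a b : ℝ) : Set ℂ := (fun t : ℝ => (t : ℂ)) '' Set.Icc a b

/-- The Markov function `z ↦ ∫ dμ(t) / (z - t)` of a measure on the real line. -/
def markovFun (μ : Measure ℝ) (z : ℂ) : ℂ := ∫ t : ℝ, 1 / (z - (t : ℂ)) ∂μ

/-- `(∫ dμ(t) / |w - t|²) / |∫ dμ(t) / (w - t)|²`. -/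
def thieleB (μ : Measure ℝ) (w : ℂ) : ℝ :=
  (∫ t : ℝ, 1 / ‖w - (t : ℂ)‖ ^ 2 ∂μ) / ‖markovFun μ w‖ ^ 2

/-- `(∫ t dμ(t) / |w - t|²) / |∫ dμ(t) / (w - t)|²`. -/
def thieleA (μ : Measure ℝ) (w : ℂ) : ℝ :=
  (∫ t : ℝ, t / ‖w - (t : ℂ)‖ ^ 2 ∂μ) / ‖markovFun μ w‖ ^ 2

/-- The diagonal entry `B_{j,j}`, for the interpolation points `z 1, z 2, …`
(the value `z 0` is never used) and the measures `ν 0, ν 1, …`. -/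
def diagB (z : ℕ → ℂ) (ν : ℕ → Measure ℝ) (j : ℕ) : ℝ := thieleB (ν j) (z (2 * j + 1))

/-- The diagonal entry `A_{j,j}`. -/
def diagA (z : ℕ → ℂ) (ν : ℕ → Measure ℝ) (j : ℕ) : ℝ := thieleA (ν j) (z (2 * j + 1))

/-- The off-diagonal entry `B_{j+1,j} = √(B_{j,j} - 1)`. -/
def offB (z : ℕ → ℂ) (ν : ℕ → Measure ℝ) (j : ℕ) : ℝ := Real.sqrt (diagB z ν j - 1)

/-- The sequence of measures generated by the expansion of the Markov function of `μ`, with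
respect to the points `z 1, z 2, …`, into a continued fraction: it starts with `μ`, it consists of
probability measures carried by `[a, b]`, and the Markov functions `φ_j` of its members satisfy
`φ_j(x) = 1 / (x B_{j,j} - A_{j,j} - B_{j+1,j}² (x - z_{2j+1}) (x - z_{2j+2}) φ_{j+1}(x))`
off `[a, b]`. -/
structure IsThieleSequence (a b : ℝ) (z : ℕ → ℂ) (μ : Measure ℝ) (ν : ℕ → Measure ℝ) : Prop where
  zero : ν 0 = μ
  prob : ∀ j, IsProbabilityMeasure (ν j)
  carried : ∀ j, ν j (Set.Icc a b)ᶜ = 0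
  step : ∀ j, ∀ x : ℂ, x ∉ complexIcc a b →
    markovFun (ν j) x =
      1 / (x * (diagB z ν j : ℂ) - (diagA z ν j : ℂ)
        - (offB z ν j : ℂ) ^ 2 * (x - z (2 * j + 1)) * (x - z (2 * j + 2))
          * markovFun (ν (j + 1)) x)

/-- The tridiagonal matrix `B`. -/
def matB (z : ℕ → ℂ) (ν : ℕ → Measure ℝ) : Matrix ℕ ℕ ℂ := fun j k =>
  if j = k then (diagB z ν j : ℂ)
  else if j = k + 1 then (offB z ν k : ℂ)
  else if k = j + 1 then (offB z ν j : ℂ)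
  else 0

/-- The tridiagonal matrix `A`: here `x B_{j+1,j} - A_{j+1,j} = B_{j+1,j} (x - z_{2j+1})` and
`x B_{j,j+1} - A_{j,j+1} = B_{j+1,j} (x - z_{2j+2})`. -/
def matA (z : ℕ → ℂ) (ν : ℕ → Measure ℝ) : Matrix ℕ ℕ ℂ := fun j k =>
  if j = k then (diagA z ν j : ℂ)
  else if j = k + 1 then (offB z ν k : ℂ) * z (2 * k + 1)
  else if k = j + 1 then (offB z ν j : ℂ) * z (2 * j + 2)
  else 0

/-- The bounded operator `T` on `ℓ²` acts as the matrix product with `M`. -/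
def ActsAsMatrix (T : SeqL2 →L[ℂ] SeqL2) (M : Matrix ℕ ℕ ℂ) : Prop :=
  ∀ (y : SeqL2) (j : ℕ), HasSum (fun k => M j k * y k) (T y j)

/-- The numerical range of the linear pencil `x B - A`. The inner product that is linear in its
first argument, `⟨u, v⟩ = ∑ u_j conj(v_j)`, is `inner ℂ v u` here. -/
def pencilNumericalRange (A B : SeqL2 →L[ℂ] SeqL2) : Set ℂ :=
  {x : ℂ | ∃ y : SeqL2, y ≠ 0 ∧ inner ℂ y ((x • B - A) y) = 0}

end

/-! Existence. Let ν be carried by `[a, b]` and by no finite set, and let `M` be multiplication by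
`t` on `L²(ν)`, `e = 1`, `h x = 1/(x - t)`, so that `φ(x) = ⟨e, h x⟩`. For `w = z_{2j+1}` the vector
`r = h w / φ(w)` splits as `e + k` with `k ⟂ e`, `‖r‖² = B_{j,j}` and `‖k‖² = B_{j,j} - 1`. The next
measure is the spectral measure, at `k/‖k‖`, of the compression of `M` to the orthogonal complement
of `e`. A Schur complement computation yields the continued fraction step
(`exists_next_measure_of_model`). If `k` vanished, or if the new measure had a finite carrier, a
nonzero polynomial in `M` would kill `e`; hence `B_{j,j} > 1` and the construction can be repeated.

Boundedness. `B_{j,j} - 1` is the variance of `1/(w - t)` over `|φ_j(w)|²`. It is of order `dist(w,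
[a, b])⁻²`, so `√(B_{j,j} - 1) |w|` stays bounded even for unbounded `z_n` (`thiele_bounds`).

Positivity. A Hermitian tridiagonal form with diagonal `d_j = q_j + |c_j|²/q_{j+1}`, `q_j > 0`, is a
sum of squares (`le_jacobiForm`). For `B` take `q_j = 1`. For real `x` off `[a, b]` the continued
fraction says that `xB - A` has this shape with `q_j = 1/φ_j(x)`, which is positive for `x > b` and
negative for `x < a`. So `⟨(xB - A)y, y⟩` is `≥ 0` to the right of `[a, b]` and `≤ 0` to its left,
and its real zero `⟨Ay, y⟩/⟨By, y⟩` lies in `[a, b]`. -/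

noncomputable section

/-! ### Spectral measures and resolvents of bounded self-adjoint operators. -/

section SpectralMeasure

variable {H : Type*} [NormedAddCommGroup H] [InnerProductSpace ℂ H] [CompleteSpace H]

theorem inner_self_eq_ofReal_norm_sq {E : Type*} [NormedAddCommGroup E] [InnerProductSpace ℂ E]
    (y : E) : inner ℂ y y = ((‖y‖ ^ 2 : ℝ) : ℂ) := by
  rw [inner_self_eq_norm_sq_to_K]
  simp

open ContinuousLinearMap in
theorem spectrum_subset_Icc_of_inner_bounds {T : H →L[ℂ] H} (hT : IsSelfAdjoint T) {a b : ℝ}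
    (ha : ∀ y, a * ‖y‖ ^ 2 ≤ (inner ℂ y (T y)).re)
    (hb : ∀ y, (inner ℂ y (T y)).re ≤ b * ‖y‖ ^ 2) :
    spectrum ℝ T ⊆ Set.Icc a b := by
  have alg : ∀ (r : ℝ) (y : H), (algebraMap ℝ (H →L[ℂ] H) r) y = (r : ℂ) • y := by
    intro r y
    rw [Algebra.algebraMap_eq_smul_one]
    simp
  have key : ∀ (r : ℝ) (y : H), (inner ℂ y ((algebraMap ℝ (H →L[ℂ] H) r) y)).re = r * ‖y‖ ^ 2 := by
    intro r y
    rw [alg, inner_smul_right, inner_self_eq_ofReal_norm_sq, ← Complex.ofReal_mul,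
      Complex.ofReal_re]
  have hsa : ∀ r : ℝ, IsSelfAdjoint (algebraMap ℝ (H →L[ℂ] H) r) := fun r => by
    rw [IsSelfAdjoint, ← algebraMap_star_comm]; simp
  have h1 : algebraMap ℝ (H →L[ℂ] H) a ≤ T := by
    rw [le_def, isPositive_def']
    refine ⟨hT.sub (hsa a), fun y => ?_⟩
    rw [reApplyInnerSelf_apply, ← inner_re_symm]
    have := key a y
    have := ha y
    simp only [sub_apply, inner_sub_right, map_sub, RCLike.re_eq_complex_re] at *
    linarith
  have h2 : T ≤ algebraMap ℝ (H →L[ℂ] H) b := by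
    rw [le_def, isPositive_def']
    refine ⟨(hsa b).sub hT, fun y => ?_⟩
    rw [reApplyInnerSelf_apply, ← inner_re_symm]
    have := key b y
    have := hb y
    simp only [sub_apply, inner_sub_right, map_sub, RCLike.re_eq_complex_re] at *
    linarith
  intro x hx
  exact ⟨(algebraMap_le_iff_le_spectrum hT).1 h1 x hx, (le_algebraMap_iff_spectrum_le hT).1 h2 x hx⟩

open CompactlySupported in
-- Riesz–Markov–Kakutani for the positive functional `f ↦ ⟨u, f(T) u⟩` on `C([a, b])`; functions are
-- extended by constants beyond the endpoints so that the functional calculus over `ℝ` applies.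
theorem exists_spectralMeasure {T : H →L[ℂ] H} (hT : IsSelfAdjoint T) {a b : ℝ} (hab : a ≤ b)
    (hs : spectrum ℝ T ⊆ Set.Icc a b) {u : H} (hu : ‖u‖ = 1) :
    ∃ ρ : Measure ℝ, IsProbabilityMeasure ρ ∧ ρ (Set.Icc a b)ᶜ = 0 ∧
      ∀ f : ℝ → ℝ, ContinuousOn f (Set.Icc a b) →
        inner ℂ u (cfc f T u) = ((∫ t, f t ∂ρ : ℝ) : ℂ) := by
  have hcont : ∀ f : C_c(Set.Icc a b, ℝ), Continuous (Set.IccExtend hab f) := fun f =>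
    (map_continuous f).Icc_extend'
  let Λ₀ : C_c(Set.Icc a b, ℝ) →ₗ[ℝ] ℝ :=
    { toFun := fun f => (inner ℂ u (cfc (Set.IccExtend hab f) T u)).re
      map_add' := fun f g => by
        have : Set.IccExtend hab (f + g) =
            fun t => Set.IccExtend hab f t + Set.IccExtend hab g t := rfl
        rw [this, cfc_add (a := T) _ _ (hcont f).continuousOn (hcont g).continuousOn]
        simp
      map_smul' := fun c f => by
        have : Set.IccExtend hab (c • f) = fun t => c • Set.IccExtend hab f t := rfl
        rw [this, cfc_smul (a := T) _ _ (hcont f).continuousOn]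
        simp }
  have hΛ : ∀ f : C_c(Set.Icc a b, ℝ), 0 ≤ f → 0 ≤ Λ₀ f := by
    intro f hf
    have h : (0 : H →L[ℂ] H) ≤ cfc (Set.IccExtend hab f) T :=
      cfc_nonneg fun x _ => hf _
    rw [ContinuousLinearMap.nonneg_iff_isPositive] at h
    exact h.re_inner_nonneg_right u
  let Λ : C_c(Set.Icc a b, ℝ) →ₚ[ℝ] ℝ := PositiveLinearMap.mk₀ Λ₀ hΛ
  let ρ₀ : Measure (Set.Icc a b) := RealRMK.rieszMeasure Λ
  have hint : ∀ f : ℝ → ℝ, ContinuousOn f (Set.Icc a b) →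
      ∫ t, f t ∂(ρ₀.map Subtype.val) = (inner ℂ u (cfc f T u)).re := by
    intro f hf
    rw [(MeasurableEmbedding.subtype_coe measurableSet_Icc).integral_map]
    have := RealRMK.integral_rieszMeasure Λ
      (CompactlySupportedContinuousMap.continuousMapEquiv ⟨_, hf.domRestrict⟩)
    refine this.trans ?_
    change (inner ℂ u (cfc (Set.IccExtend hab (Set.domRestrict (Set.Icc a b) f)) T u)).re = _
    rw [cfc_congr (g := f)]
    intro t ht
    exact Set.IccExtend_of_mem hab (Set.domRestrict (Set.Icc a b) f) (hs ht)
  have : IsFiniteMeasure ρ₀ := inferInstance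
  have hfin : IsFiniteMeasure (ρ₀.map Subtype.val) := inferInstance
  refine ⟨ρ₀.map Subtype.val, ⟨?_⟩, ?_, fun f hf => ?_⟩
  · have := hint (fun _ => 1) continuousOn_const
    rw [cfc_const_one ℝ T] at this
    simp [hu, inner_self_eq_norm_sq_to_K, Measure.real] at this
    simpa [ENNReal.toReal_eq_one_iff] using this
  · rw [Measure.map_apply measurable_subtype_coe measurableSet_Icc.compl]
    simp
  · rw [hint f hf]
    have : IsSelfAdjoint (cfc f T) := cfc_predicate f T
    exact (this.isSymmetric.coe_re_inner_self_apply u).symm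

theorem norm_sq_aeval_apply {T : H →L[ℂ] H} (hT : IsSelfAdjoint T) {a b : ℝ} {u : H}
    {ρ : Measure ℝ}
    (hρ : ∀ f : ℝ → ℝ, ContinuousOn f (Set.Icc a b) →
      inner ℂ u (cfc f T u) = ((∫ t, f t ∂ρ : ℝ) : ℂ)) (p : Polynomial ℝ) :
    ‖Polynomial.aeval T p u‖ ^ 2 = ∫ t, p.eval t ^ 2 ∂ρ := by
  have h : inner ℂ (cfc p.eval T u) (cfc p.eval T u) = inner ℂ u (cfc (fun t => p.eval t ^ 2) T u) := by
    have hsa : IsSelfAdjoint (cfc p.eval T) := cfc_predicate _ T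
    have := hsa.isSymmetric u (cfc p.eval T u)
    simp only [ContinuousLinearMap.coe_coe] at this
    rw [this, cfc_pow _ 2 T p.continuous.continuousOn, pow_two]
    rfl
  rw [hρ _ (by fun_prop), cfc_polynomial p T hT, inner_self_eq_ofReal_norm_sq] at h
  exact_mod_cast h

/-- Only the real functional calculus is used: `1/(x - t) = S(t) - i (Im x) R(t)` with `R = 1/|x -
t|²` and `S = (Re x - t) R`. -/
theorem exists_resolvent_apply {T : H →L[ℂ] H} (hT : IsSelfAdjoint T) {a b : ℝ}
    (hs : spectrum ℝ T ⊆ Set.Icc a b) {u : H} {ρ : Measure ℝ} [IsProbabilityMeasure ρ]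
    (hρ0 : ρ (Set.Icc a b)ᶜ = 0)
    (hρ : ∀ f : ℝ → ℝ, ContinuousOn f (Set.Icc a b) →
      inner ℂ u (cfc f T u) = ((∫ t, f t ∂ρ : ℝ) : ℂ)) {x : ℂ} (hx : x ∉ complexIcc a b) :
    ∃ g : H, x • g - T g = u ∧ inner ℂ u g = markovFun ρ x := by
  have hne : ∀ t ∈ Set.Icc a b, x - (t : ℂ) ≠ 0 := fun t ht h =>
    hx ⟨t, ht, (sub_eq_zero.1 h).symm⟩
  let N : ℝ → ℝ := fun t => Complex.normSq (x - t)
  have hN : ∀ t ∈ Set.Icc a b, N t ≠ 0 := fun t ht => by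
    simpa [N] using hne t ht
  have hNc : Continuous N := by
    simp only [N]; exact Complex.continuous_normSq.comp (by fun_prop)
  let R : ℝ → ℝ := fun t => (N t)⁻¹
  have hR : ContinuousOn R (Set.Icc a b) := hNc.continuousOn.inv₀ hN
  let S : ℝ → ℝ := fun t => (x.re - t) * R t
  have hS : ContinuousOn S (Set.Icc a b) := by fun_prop
  have hl : ContinuousOn (fun t : ℝ => x.re - t) (spectrum ℝ T) := by fun_prop
  have hlin : ∀ y : H, cfc (fun t : ℝ => x.re - t) T y = (x.re : ℂ) • y - T y := by
    intro y
    rw [cfc_sub (a := T) _ _ (by fun_prop) (by fun_prop), cfc_const x.re T, cfc_id' ℝ T,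
      Algebra.algebraMap_eq_smul_one]
    simp
  have hSR : ∀ y : H, (x.re : ℂ) • cfc R T y - T (cfc R T y) = cfc S T y := by
    intro y
    rw [← hlin, cfc_mul _ R T hl (hR.mono hs)]
    rfl
  have hSS : ∀ y : H, (x.re : ℂ) • cfc S T y - T (cfc S T y) + ((x.im : ℂ) ^ 2) • cfc R T y = y := by
    intro y
    have h1 : cfc (fun t => (x.re - t) * S t + x.im ^ 2 • R t) T = 1 := by
      rw [← cfc_one ℝ T]
      refine cfc_congr fun t ht => ?_
      have := hN t (hs ht)
      simp only [S, R, smul_eq_mul, Pi.one_apply]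
      field_simp
      simp [N, Complex.normSq_apply]
      ring
    rw [cfc_add (a := T) _ _ (by exact hl.mul (hS.mono hs)) (by exact (hR.mono hs).const_smul (x.im ^ 2)),
      cfc_mul _ S T hl (hS.mono hs), cfc_smul _ _ T (hR.mono hs)] at h1
    have h2 := congrArg (fun F : H →L[ℂ] H => F y) h1
    change cfc (fun t : ℝ => x.re - t) T (cfc S T y) + (x.im ^ 2) • (cfc R T y) = y at h2
    rw [hlin] at h2
    rw [← Complex.coe_smul, Complex.ofReal_pow] at h2
    exact h2
  refine ⟨cfc S T u - (x.im * Complex.I : ℂ) • cfc R T u, ?_, ?_⟩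
  · have e1 := hSR u
    have e2 := hSS u
    rw [map_sub, map_smul]
    have hxx : x = x.re + x.im * Complex.I := (Complex.re_add_im x).symm
    nth_rewrite 1 [hxx]
    have h3 : T (cfc S T u) = (x.re : ℂ) • cfc S T u + ((x.im : ℂ) ^ 2) • cfc R T u - u := by
      have aux : ∀ p q r v : H, q - p + r = v → p = q + r - v := by rintro p q r v rfl; abel
      exact aux _ _ _ _ e2
    have h4 : T (cfc R T u) = (x.re : ℂ) • cfc R T u - cfc S T u := by
      rw [← e1]; abel
    rw [h3, h4]
    match_scalars <;> ring_nf <;> simp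
  · rw [inner_sub_right, inner_smul_right, hρ _ hS, hρ _ hR]
    have hae : ∀ᵐ t ∂ρ, t ∈ Set.Icc a b := by
      rw [ae_iff]; exact hρ0
    have hi : ∀ f : ℝ → ℝ, ContinuousOn f (Set.Icc a b) → Integrable f ρ := by
      intro f hf
      have : IntegrableOn f (Set.Icc a b) ρ := hf.integrableOn_compact isCompact_Icc
      rwa [IntegrableOn, Measure.restrict_eq_self_of_ae_mem hae] at this
    rw [← integral_complex_ofReal, ← integral_complex_ofReal, ← integral_const_mul,
      ← integral_sub (hi S hS).ofReal ((hi R hR).ofReal.const_mul _), markovFun]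
    refine integral_congr_ae (hae.mono fun t ht => ?_)
    have h0 := hne t ht
    have h1 : (x - t) * (starRingEnd ℂ) (x - t) = (N t : ℂ) := Complex.mul_conj _
    have h2 : (N t : ℂ) ≠ 0 := by exact_mod_cast hN t ht
    simp only [S, R]
    push_cast
    rw [eq_div_iff h0]
    field_simp
    rw [← h1, mul_comm]
    congr 1
    apply Complex.ext <;> simp

end SpectralMeasure
-- Multiplication by the variable on `L²(ν)`.
theorem sub_ofReal_ne_zero {a b : ℝ} {x : ℂ} (hx : x ∉ complexIcc a b) {t : ℝ}
    (ht : t ∈ Set.Icc a b) : x - (t : ℂ) ≠ 0 := fun h =>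
  hx ⟨t, ht, (sub_eq_zero.1 h).symm⟩

theorem continuousOn_one_div_sub {a b : ℝ} {x : ℂ} (hx : x ∉ complexIcc a b) :
    ContinuousOn (fun t : ℝ => 1 / (x - (t : ℂ))) (Set.Icc a b) :=
  continuousOn_const.div (by fun_prop) fun _ ht => sub_ofReal_ne_zero hx ht

theorem ae_mem_Icc {ν : Measure ℝ} {a b : ℝ} (hν : ν (Set.Icc a b)ᶜ = 0) :
    ∀ᵐ t ∂ν, t ∈ Set.Icc a b := by
  rw [ae_iff]; exact hν

theorem integrable_of_continuousOn_Icc {E : Type*} [NormedAddCommGroup E] [NormedSpace ℝ E]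
    {ν : Measure ℝ} [IsFiniteMeasure ν] {a b : ℝ}
    (hν : ν (Set.Icc a b)ᶜ = 0) {f : ℝ → E} (hf : ContinuousOn f (Set.Icc a b)) :
    Integrable f ν := by
  have : IntegrableOn f (Set.Icc a b) ν := hf.integrableOn_compact isCompact_Icc
  rwa [IntegrableOn, Measure.restrict_eq_self_of_ae_mem (ae_mem_Icc hν)] at this

theorem memLp_top_of_continuousOn_Icc {ν : Measure ℝ} [IsFiniteMeasure ν] {a b : ℝ}
    (hν : ν (Set.Icc a b)ᶜ = 0) {f : ℝ → ℂ} (hf : ContinuousOn f (Set.Icc a b)) :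
    MemLp f ⊤ ν := by
  obtain ⟨C, hC⟩ := isCompact_Icc.exists_bound_of_continuousOn hf
  exact memLp_top_of_bound (integrable_of_continuousOn_Icc hν hf).aestronglyMeasurable C
    ((ae_mem_Icc hν).mono hC)

/-- The last clause turns a polynomial relation `p(M) e = 0` into the vanishing of `p` almost
everywhere, which forces `p = 0` when no finite set carries the measure. -/
theorem exists_multiplication_model {ν : Measure ℝ} [IsProbabilityMeasure ν] {a b : ℝ}
    (hν : ν (Set.Icc a b)ᶜ = 0) :
    ∃ (M : Lp ℂ 2 ν →L[ℂ] Lp ℂ 2 ν) (e : Lp ℂ 2 ν) (h : ℂ → Lp ℂ 2 ν),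
      IsSelfAdjoint M ∧ (∀ y, a * ‖y‖ ^ 2 ≤ (inner ℂ y (M y)).re) ∧
      (∀ y, (inner ℂ y (M y)).re ≤ b * ‖y‖ ^ 2) ∧ ‖e‖ = 1 ∧
      (∀ x ∉ complexIcc a b, x • h x - M (h x) = e ∧ inner ℂ e (h x) = markovFun ν x ∧
        ‖h x‖ ^ 2 = ∫ t, 1 / ‖x - (t : ℂ)‖ ^ 2 ∂ν ∧
        inner ℂ (h x) (M (h x)) = ((∫ t, t / ‖x - (t : ℂ)‖ ^ 2 ∂ν : ℝ) : ℂ)) ∧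
      ∀ p : Polynomial ℂ, Polynomial.aeval M p e = 0 → ∀ᵐ t : ℝ ∂ν, p.eval (t : ℂ) = 0 := by
  classical
  have hm : MemLp (fun t : ℝ => (t : ℂ)) ⊤ ν := memLp_top_of_continuousOn_Icc (a := a) (b := b) hν
    (by fun_prop)
  let M : Lp ℂ 2 ν →L[ℂ] Lp ℂ 2 ν :=
    (ContinuousLinearMap.mul ℂ ℂ).holderL ν ⊤ 2 2 (hm.toLp _)
  have hM : ∀ y : Lp ℂ 2 ν, M y =ᵐ[ν] fun t => (t : ℂ) * y t := by
    intro y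
    filter_upwards [(ContinuousLinearMap.mul ℂ ℂ).coeFn_holder (r := 2) (hm.toLp _) y,
      hm.coeFn_toLp] with t h1 h2
    refine h1.trans ?_
    rw [h2]; rfl
  have h1 : MemLp (fun _ : ℝ => (1 : ℂ)) 2 ν := memLp_const 1
  let e : Lp ℂ 2 ν := h1.toLp _
  have he : e =ᵐ[ν] fun _ => (1 : ℂ) := h1.coeFn_toLp
  have hmem : ∀ x ∉ complexIcc a b, MemLp (fun t : ℝ => 1 / (x - (t : ℂ))) 2 ν := fun x hx =>
    (memLp_top_of_continuousOn_Icc hν (continuousOn_one_div_sub hx)).mono_exponent le_top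
  let h : ℂ → Lp ℂ 2 ν := fun x =>
    if hx : x ∈ complexIcc a b then 0 else (hmem x hx).toLp _
  have hh : ∀ x ∉ complexIcc a b, h x =ᵐ[ν] fun t : ℝ => 1 / (x - (t : ℂ)) := by
    intro x hx
    simp only [h, dif_neg hx]
    exact (hmem x hx).coeFn_toLp
  have hnormsq : ∀ y : Lp ℂ 2 ν, ‖y‖ ^ 2 = ∫ t, ‖y t‖ ^ 2 ∂ν := by
    intro y
    have := inner_self_eq_ofReal_norm_sq y
    rw [L2.inner_def] at this
    simp only [inner_self_eq_ofReal_norm_sq] at this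
    rw [integral_complex_ofReal] at this
    exact_mod_cast this.symm
  have hint : ∀ y : Lp ℂ 2 ν, Integrable (fun t => ‖y t‖ ^ 2) ν := fun y =>
    (Lp.memLp y).norm.integrable_sq
  have hinner : ∀ y : Lp ℂ 2 ν, inner ℂ y (M y) = ((∫ t, t * ‖y t‖ ^ 2 ∂ν : ℝ) : ℂ) := by
    intro y
    rw [L2.inner_def, ← integral_complex_ofReal]
    refine integral_congr_ae ((hM y).mono fun t ht => ?_)
    change inner ℂ (y t) (M y t) = ((t * ‖y t‖ ^ 2 : ℝ) : ℂ)
    rw [ht]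
    change inner ℂ (y t) ((t : ℂ) • y t) = ((t * ‖y t‖ ^ 2 : ℝ) : ℂ)
    rw [inner_smul_right, inner_self_eq_ofReal_norm_sq, ← Complex.ofReal_mul]
  have hint' : ∀ y : Lp ℂ 2 ν, Integrable (fun t => t * ‖y t‖ ^ 2) ν := by
    intro y
    refine (hint y).bdd_mul (c := max |a| |b|) (by fun_prop) ?_
    filter_upwards [ae_mem_Icc hν] with t ht
    exact abs_le_max_abs_abs ht.1 ht.2
  refine ⟨M, e, h, ?_, ?_, ?_, ?_, ?_, ?_⟩
  · rw [ContinuousLinearMap.isSelfAdjoint_iff_isSymmetric]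
    intro x y
    simp only [ContinuousLinearMap.coe_coe]
    rw [L2.inner_def, L2.inner_def]
    refine integral_congr_ae ?_
    filter_upwards [hM x, hM y] with t hx hy
    rw [hx, hy]
    simp
    ring
  · intro y
    rw [hinner, Complex.ofReal_re, hnormsq, ← integral_const_mul]
    refine integral_mono_ae ((hint y).const_mul _) (hint' y) ?_
    filter_upwards [ae_mem_Icc hν] with t ht
    exact mul_le_mul_of_nonneg_right ht.1 (sq_nonneg _)
  · intro y
    rw [hinner, Complex.ofReal_re, hnormsq, ← integral_const_mul]
    refine integral_mono_ae (hint' y) ((hint y).const_mul _) ?_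
    filter_upwards [ae_mem_Icc hν] with t ht
    exact mul_le_mul_of_nonneg_right ht.2 (sq_nonneg _)
  · have : ‖e‖ ^ 2 = 1 := by
      rw [hnormsq, integral_congr_ae (he.mono fun t ht => by rw [ht])]
      simp
    exact (pow_eq_one_iff_of_nonneg (norm_nonneg e) two_ne_zero).1 this
  · intro x hx
    refine ⟨?_, ?_, ?_, ?_⟩
    · refine Lp.ext ?_
      filter_upwards [Lp.coeFn_sub (x • h x) (M (h x)), Lp.coeFn_smul x (h x), hM (h x), hh x hx,
        he, ae_mem_Icc hν] with t e1 e2 e3 e4 e5 e6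
      have := sub_ofReal_ne_zero hx e6
      rw [e1, Pi.sub_apply, e2, Pi.smul_apply, e3, e4, e5, smul_eq_mul]
      field_simp
    · rw [L2.inner_def, markovFun]
      refine integral_congr_ae ?_
      filter_upwards [he, hh x hx] with t e1 e2
      rw [e1, e2]
      simp
    · rw [hnormsq]
      refine integral_congr_ae ?_
      filter_upwards [hh x hx] with t e1
      rw [e1]
      simp
    · rw [hinner]
      congr 1
      refine integral_congr_ae ?_
      filter_upwards [hh x hx] with t e1
      rw [e1]
      simp [div_eq_mul_inv]
  · intro p hp
    have key : ∀ p : Polynomial ℂ, (Polynomial.aeval M p e : Lp ℂ 2 ν) =ᵐ[ν]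
        fun t => p.eval (t : ℂ) := by
      intro p
      induction p using Polynomial.induction_on with
      | C c =>
        rw [Polynomial.aeval_C, Algebra.algebraMap_eq_smul_one]
        filter_upwards [Lp.coeFn_smul c e, he] with t e1 e2
        change (c • e : Lp ℂ 2 ν) t = _
        rw [e1, Pi.smul_apply, e2]
        simp
      | add p q hp hq =>
        rw [map_add]
        filter_upwards [Lp.coeFn_add (Polynomial.aeval M p e) (Polynomial.aeval M q e), hp, hq]
          with t e1 e2 e3
        refine e1.trans ?_
        rw [Pi.add_apply, e2, e3, Polynomial.eval_add]
      | monomial n c ih =>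
        have : (Polynomial.C c * Polynomial.X ^ (n + 1) : Polynomial ℂ) =
            Polynomial.X * (Polynomial.C c * Polynomial.X ^ n) := by ring
        rw [this, map_mul, Polynomial.aeval_X]
        filter_upwards [hM (Polynomial.aeval M (Polynomial.C c * Polynomial.X ^ n) e), ih]
          with t e1 e2
        refine e1.trans ?_
        rw [e2]
        simp
    filter_upwards [key p, Lp.coeFn_zero ℂ 2 ν] with t e1 e2
    rw [← e1, hp, e2]
    rfl

/-! ### Bounds for the matrix entries. -/

section Estimates

variable {ν : Measure ℝ} [IsProbabilityMeasure ν] {a b : ℝ}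

theorem continuousOn_one_div_norm_sq {w : ℂ} (hw : w ∉ complexIcc a b) :
    ContinuousOn (fun t : ℝ => 1 / ‖w - (t : ℂ)‖ ^ 2) (Set.Icc a b) :=
  continuousOn_const.div (by fun_prop) fun _ ht =>
    pow_ne_zero 2 (norm_ne_zero_iff.2 (sub_ofReal_ne_zero hw ht))

theorem complex_norm_sub_sq {w c : ℂ} :
    ‖w - c‖ ^ 2 = ‖w‖ ^ 2 - 2 * (starRingEnd ℂ c * w).re + ‖c‖ ^ 2 := by
  simp only [Complex.sq_norm, Complex.normSq_apply, Complex.sub_re, Complex.sub_im,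
    Complex.mul_re, Complex.conj_re, Complex.conj_im]
  ring

theorem integral_norm_sub_const_sq (hν : ν (Set.Icc a b)ᶜ = 0) {w : ℂ}
    (hw : w ∉ complexIcc a b) (c : ℂ) :
    ∫ t : ℝ, ‖1 / (w - (t : ℂ)) - c‖ ^ 2 ∂ν =
      ∫ t : ℝ, 1 / ‖w - (t : ℂ)‖ ^ 2 ∂ν - 2 * (starRingEnd ℂ c * markovFun ν w).re + ‖c‖ ^ 2 := by
  have i1 := integrable_of_continuousOn_Icc hν (continuousOn_one_div_norm_sq hw)
  have i2 := integrable_of_continuousOn_Icc hν (continuousOn_one_div_sub hw)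
  have i3 : Integrable (fun t : ℝ => (starRingEnd ℂ c * (1 / (w - (t : ℂ)))).re) ν :=
    (i2.const_mul _).re
  have e : (fun t : ℝ => ‖1 / (w - (t : ℂ)) - c‖ ^ 2) = fun t : ℝ =>
      1 / ‖w - (t : ℂ)‖ ^ 2 - 2 * (starRingEnd ℂ c * (1 / (w - (t : ℂ)))).re + ‖c‖ ^ 2 := by
    ext t
    rw [complex_norm_sub_sq]
    simp
  have e3 : ∫ t : ℝ, (starRingEnd ℂ c * (1 / (w - (t : ℂ)))).re ∂ν =
      (starRingEnd ℂ c * markovFun ν w).re := by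
    rw [markovFun, ← integral_const_mul]
    exact integral_re (i2.const_mul _)
  have i4 : Integrable (fun t : ℝ => 1 / ‖w - (t : ℂ)‖ ^ 2 -
      2 * (starRingEnd ℂ c * (1 / (w - (t : ℂ)))).re) ν := i1.sub (i3.const_mul 2)
  rw [e, integral_add i4 (integrable_const _),
    integral_sub i1 (i3.const_mul 2), integral_const_mul, e3]
  simp

/-- Here `d` is the distance from `w` to its nearest point `t₀` in `[a, b]`. The last two bounds
concern the variance of `1/(w - t)`: it is nonnegative, and at most the mean square deviation from
the constant `1/(w - t₀)`. -/
theorem markovFun_estimates (hab : a ≤ b) (hν : ν (Set.Icc a b)ᶜ = 0) {w : ℂ}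
    (hw : w ∉ complexIcc a b) :
    ∃ d > 0, Metric.infDist w (complexIcc a b) ≤ d ∧ ‖w‖ ≤ max |a| |b| + d ∧
      d * (∫ t : ℝ, 1 / ‖w - (t : ℂ)‖ ^ 2 ∂ν) ≤ ‖markovFun ν w‖ ∧
      1 / (d + (b - a)) ^ 2 ≤ ∫ t : ℝ, 1 / ‖w - (t : ℂ)‖ ^ 2 ∂ν ∧
      ‖markovFun ν w‖ ^ 2 ≤ ∫ t : ℝ, 1 / ‖w - (t : ℂ)‖ ^ 2 ∂ν ∧
      (∫ t : ℝ, 1 / ‖w - (t : ℂ)‖ ^ 2 ∂ν) - ‖markovFun ν w‖ ^ 2 ≤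
        (b - a) ^ 2 / d ^ 2 * ∫ t : ℝ, 1 / ‖w - (t : ℂ)‖ ^ 2 ∂ν := by
  obtain ⟨t₀, ht₀, hproj⟩ : ∃ t₀ ∈ Set.Icc a b, ∀ t ∈ Set.Icc a b, 0 ≤ (w.re - t₀) * (t₀ - t) := by
    rcases le_total w.re a with h | h
    · exact ⟨a, ⟨le_rfl, hab⟩, fun t ht => mul_nonneg_of_nonpos_of_nonpos (by linarith)
        (by linarith [ht.1])⟩
    rcases le_total w.re b with h' | h'
    · exact ⟨w.re, ⟨h, h'⟩, fun t _ => by simp⟩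
    · exact ⟨b, ⟨hab, le_rfl⟩, fun t ht => mul_nonneg (by linarith) (by linarith [ht.2])⟩
  set d : ℝ := ‖w - (t₀ : ℂ)‖ with hd
  have hd0 : 0 < d := norm_pos_iff.2 (sub_ofReal_ne_zero hw ht₀)
  have i1 := integrable_of_continuousOn_Icc hν (continuousOn_one_div_norm_sq hw)
  have i2 := integrable_of_continuousOn_Icc hν (continuousOn_one_div_sub hw)
  -- The variational inequality for the projection `t₀`: all vectors `w - t` lean in the direction
  -- of `w - t₀`, so no cancellation can make the Markov function small.
  have hpt : ∀ t ∈ Set.Icc a b, d ^ 2 ≤ ((w - (t₀ : ℂ)) * starRingEnd ℂ (w - (t : ℂ))).re := by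
    intro t ht
    have := hproj t ht
    rw [hd]
    simp only [Complex.sq_norm, Complex.normSq_apply, Complex.mul_re, Complex.sub_re,
      Complex.sub_im, Complex.conj_re, Complex.conj_im, Complex.ofReal_re, Complex.ofReal_im]
    nlinarith
  have hle : ∀ t ∈ Set.Icc a b, d ≤ ‖w - (t : ℂ)‖ := by
    intro t ht
    have h1 := (hpt t ht).trans (Complex.re_le_norm _)
    rw [norm_mul, RCLike.norm_conj, ← hd] at h1
    nlinarith
  have habs : ∀ t ∈ Set.Icc a b, |t - t₀| ≤ b - a := fun t ht => by
    rw [abs_le]; constructor <;> linarith [ht.1, ht.2, ht₀.1, ht₀.2]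
  have hle' : ∀ t ∈ Set.Icc a b, ‖w - (t : ℂ)‖ ≤ d + (b - a) := by
    intro t ht
    have : w - (t : ℂ) = (w - t₀) - ((t - t₀ : ℝ) : ℂ) := by push_cast; ring
    rw [this]
    refine (norm_sub_le _ _).trans ?_
    rw [Complex.norm_real, Real.norm_eq_abs]
    linarith [habs t ht]
  refine ⟨d, hd0, ?_, ?_, ?_, ?_, ?_, ?_⟩
  · have := Metric.infDist_le_dist_of_mem (x := w) (s := complexIcc a b) ⟨t₀, ht₀, rfl⟩
    rwa [dist_eq_norm] at this
  · have : w = (t₀ : ℂ) + (w - t₀) := by ring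
    calc ‖w‖ = ‖(t₀ : ℂ) + (w - t₀)‖ := by rw [← this]
      _ ≤ ‖(t₀ : ℂ)‖ + d := norm_add_le _ _
      _ ≤ _ := by
        rw [Complex.norm_real]
        have := abs_le_max_abs_abs ht₀.1 ht₀.2
        rw [Real.norm_eq_abs]; linarith
  · have h1 : d ^ 2 * (∫ t : ℝ, 1 / ‖w - (t : ℂ)‖ ^ 2 ∂ν) ≤ ((w - t₀) * markovFun ν w).re := by
      have e3 : ∫ t : ℝ, ((w - t₀) * (1 / (w - (t : ℂ)))).re ∂ν = ((w - t₀) * markovFun ν w).re := by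
        rw [markovFun, ← integral_const_mul]
        exact integral_re (i2.const_mul _)
      rw [← e3, ← integral_const_mul]
      refine integral_mono_ae (i1.const_mul _) (i2.const_mul _).re ?_
      filter_upwards [ae_mem_Icc hν] with t ht
      have h2 : 1 / (w - (t : ℂ)) = starRingEnd ℂ (w - (t : ℂ)) * ((1 / ‖w - (t : ℂ)‖ ^ 2 : ℝ) : ℂ) := by
        rw [one_div, Complex.inv_def, Complex.normSq_eq_norm_sq, one_div]
      rw [h2, ← mul_assoc]
      change _ ≤ (_ * ((_ : ℝ) : ℂ)).re
      rw [Complex.re_mul_ofReal]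
      exact mul_le_mul_of_nonneg_right (hpt t ht) (by positivity)
    have h2 := h1.trans (Complex.re_le_norm _)
    rw [norm_mul, ← hd, pow_two, mul_assoc] at h2
    exact le_of_mul_le_mul_left h2 hd0
  · have : ∫ t : ℝ, 1 / (d + (b - a)) ^ 2 ∂ν ≤ ∫ t : ℝ, 1 / ‖w - (t : ℂ)‖ ^ 2 ∂ν := by
      refine integral_mono_ae (integrable_const _) i1 ?_
      filter_upwards [ae_mem_Icc hν] with t ht
      have h0 := hle t ht
      have h1 := hle' t ht
      have : 0 < ‖w - (t : ℂ)‖ := hd0.trans_le h0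
      gcongr
    simpa using this
  · have h1 := integral_norm_sub_const_sq hν hw (markovFun ν w)
    have h2 : 0 ≤ ∫ t : ℝ, ‖1 / (w - (t : ℂ)) - markovFun ν w‖ ^ 2 ∂ν :=
      integral_nonneg fun t => by positivity
    rw [Complex.conj_mul', ← Complex.ofReal_pow, Complex.ofReal_re] at h1
    linarith
  · have h1 := integral_norm_sub_const_sq hν hw (1 / (w - t₀))
    have h3 := complex_norm_sub_sq (w := markovFun ν w) (c := 1 / (w - t₀))
    have h2 : ∫ t : ℝ, ‖1 / (w - (t : ℂ)) - 1 / (w - t₀)‖ ^ 2 ∂ν ≤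
        (b - a) ^ 2 / d ^ 2 * ∫ t : ℝ, 1 / ‖w - (t : ℂ)‖ ^ 2 ∂ν := by
      rw [← integral_const_mul]
      refine integral_mono_ae ?_ (i1.const_mul _) ?_
      · exact integrable_of_continuousOn_Icc hν
          (((continuousOn_one_div_sub hw).sub continuousOn_const).norm.pow 2)
      filter_upwards [ae_mem_Icc hν] with t ht
      have n1 := sub_ofReal_ne_zero hw ht
      have n2 := sub_ofReal_ne_zero hw ht₀
      have : 1 / (w - (t : ℂ)) - 1 / (w - t₀) = ((t - t₀ : ℝ) : ℂ) / ((w - t₀) * (w - t)) := by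
        push_cast; field_simp; ring
      rw [this, norm_div, norm_mul, Complex.norm_real, Real.norm_eq_abs, ← hd, div_pow, mul_pow,
        div_mul_div_comm, mul_one]
      gcongr
      exact habs t ht
    nlinarith [sq_nonneg ‖markovFun ν w - 1 / (w - t₀)‖]

theorem integral_one_div_norm_sq_pos (hab : a ≤ b) (hν : ν (Set.Icc a b)ᶜ = 0) {w : ℂ}
    (hw : w ∉ complexIcc a b) : 0 < ∫ t : ℝ, 1 / ‖w - (t : ℂ)‖ ^ 2 ∂ν := by
  obtain ⟨d, hd, -, -, -, h, -, -⟩ := markovFun_estimates hab hν hw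
  exact lt_of_lt_of_le (by have : 0 < d + (b - a) := by linarith
                           positivity) h

theorem markovFun_ne_zero (hab : a ≤ b) (hν : ν (Set.Icc a b)ᶜ = 0) {w : ℂ}
    (hw : w ∉ complexIcc a b) : markovFun ν w ≠ 0 := by
  obtain ⟨d, hd, -, -, h, -, -, -⟩ := markovFun_estimates hab hν hw
  have := integral_one_div_norm_sq_pos hab hν hw
  exact norm_pos_iff.1 (lt_of_lt_of_le (by positivity) h)

theorem one_le_thieleB (hab : a ≤ b) (hν : ν (Set.Icc a b)ᶜ = 0) {w : ℂ}
    (hw : w ∉ complexIcc a b) : 1 ≤ thieleB ν w := by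
  obtain ⟨d, hd, -, -, -, -, h, -⟩ := markovFun_estimates hab hν hw
  have := norm_pos_iff.2 (markovFun_ne_zero hab hν hw)
  rwa [thieleB, one_le_div (by positivity)]

/-- The third bound compensates a large `w`: the square root is `O(1/d)` while `‖w‖ ≤ max |a| |b| +
d`. -/
theorem thiele_bounds (hab : a ≤ b) (hν : ν (Set.Icc a b)ᶜ = 0) {w : ℂ} {δ : ℝ} (hδ : 0 < δ)
    (hw : δ < Metric.infDist w (complexIcc a b)) :
    thieleB ν w ≤ (1 + (b - a) / δ) ^ 2 ∧
      |thieleA ν w| ≤ max |a| |b| * (1 + (b - a) / δ) ^ 2 ∧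
      √(thieleB ν w - 1) * ‖w‖ ≤ (max |a| |b| / δ + 1) * (b - a) * (1 + (b - a) / δ) := by
  have hw' : w ∉ complexIcc a b := fun h => by
    rw [Metric.infDist_zero_of_mem h] at hw; linarith
  obtain ⟨d, hd, hinf, hwd, h1, h2, h3, h4⟩ := markovFun_estimates hab hν hw'
  have hI := integral_one_div_norm_sq_pos hab hν hw'
  have hφ := norm_pos_iff.2 (markovFun_ne_zero hab hν hw')
  have hδd : δ ≤ d := hw.le.trans hinf
  have hB1 := one_le_thieleB hab hν hw'
  have hL : 0 ≤ b - a := by linarith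
  have hA : |thieleA ν w| ≤ max |a| |b| * thieleB ν w := by
    rw [thieleA, thieleB, abs_div, abs_of_nonneg (sq_nonneg ‖markovFun ν w‖), ← mul_div_assoc]
    gcongr
    have i1 := integrable_of_continuousOn_Icc hν (continuousOn_one_div_norm_sq hw')
    rw [← integral_const_mul, ← Real.norm_eq_abs]
    refine norm_integral_le_of_norm_le (i1.const_mul _) ?_
    filter_upwards [ae_mem_Icc hν] with t ht
    rw [norm_div, norm_pow, norm_norm, Real.norm_eq_abs, div_eq_mul_one_div]
    gcongr
    exact abs_le_max_abs_abs ht.1 ht.2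
  rw [thieleB] at hB1 hA ⊢
  set I := ∫ t : ℝ, 1 / ‖w - (t : ℂ)‖ ^ 2 ∂ν
  set φ := ‖markovFun ν w‖
  have hBd : I / φ ^ 2 ≤ (1 + (b - a) / d) ^ 2 := by
    have e1 : (1 + (b - a) / d) ^ 2 = (d + (b - a)) ^ 2 / d ^ 2 := by field_simp
    rw [e1, div_le_div_iff₀ (by positivity) (by positivity)]
    have h5 : 1 ≤ I * (d + (b - a)) ^ 2 := by
      rwa [div_le_iff₀ (by positivity)] at h2
    have h6 : (d * I) ^ 2 ≤ φ ^ 2 := by gcongr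
    calc I * d ^ 2 ≤ I * d ^ 2 * (I * (d + (b - a)) ^ 2) := le_mul_of_one_le_right (by positivity) h5
      _ = (d + (b - a)) ^ 2 * (d * I) ^ 2 := by ring
      _ ≤ _ := by gcongr
  have hB : I / φ ^ 2 ≤ (1 + (b - a) / δ) ^ 2 := hBd.trans (by gcongr)
  refine ⟨hB, hA.trans (by gcongr), ?_⟩
  have h5 : I / φ ^ 2 - 1 ≤ ((b - a) / d * (1 + (b - a) / d)) ^ 2 := by
    have : I / φ ^ 2 - 1 = (I - φ ^ 2) / φ ^ 2 := by field_simp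
    rw [this]
    calc (I - φ ^ 2) / φ ^ 2 ≤ (b - a) ^ 2 / d ^ 2 * I / φ ^ 2 := by gcongr
      _ = ((b - a) / d) ^ 2 * (I / φ ^ 2) := by ring
      _ ≤ ((b - a) / d) ^ 2 * (1 + (b - a) / d) ^ 2 := by gcongr
      _ = _ := by ring
  have h6 : √(I / φ ^ 2 - 1) ≤ (b - a) / d * (1 + (b - a) / d) :=
    Real.sqrt_le_iff.2 ⟨by positivity, h5⟩
  calc √(I / φ ^ 2 - 1) * ‖w‖ ≤ (b - a) / d * (1 + (b - a) / d) * (max |a| |b| + d) := by gcongr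
    _ = (max |a| |b| / d + 1) * (b - a) * (1 + (b - a) / d) := by field_simp
    _ ≤ _ := by gcongr

end Estimates
-- One step of the continued fraction, by compression of an operator.
section Step

variable {H : Type*} [NormedAddCommGroup H] [InnerProductSpace ℂ H]

theorem inner_self_unit {e : H} (he : ‖e‖ = 1) : inner ℂ e e = (1 : ℂ) := by
  rw [inner_self_eq_ofReal_norm_sq, he]; simp

theorem norm_sq_eq_of_unit {e : H} (he : ‖e‖ = 1) (y : H) :
    ‖y‖ ^ 2 = ‖y - inner ℂ e y • e‖ ^ 2 + ‖inner ℂ e y‖ ^ 2 := by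
  have h := inner_self_eq_ofReal_norm_sq (y - inner ℂ e y • e)
  simp only [inner_sub_right, inner_sub_left, inner_smul_right, inner_smul_left,
    inner_self_unit he] at h
  rw [inner_self_eq_ofReal_norm_sq, ← inner_conj_symm y e] at h
  have hc := Complex.conj_mul' (inner ℂ e y)
  have h' : ((‖y‖ ^ 2 - ‖inner ℂ e y‖ ^ 2 : ℝ) : ℂ) = ((‖y - inner ℂ e y • e‖ ^ 2 : ℝ) : ℂ) := by
    push_cast at h ⊢
    linear_combination h + hc
  have := Complex.ofReal_injective h'
  linarith

theorem conj_notMem_complexIcc {a b : ℝ} {x : ℂ} (hx : x ∉ complexIcc a b) :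
    starRingEnd ℂ x ∉ complexIcc a b := by
  rintro ⟨t, ht, h⟩
  refine hx ⟨t, ht, ?_⟩
  rw [← Complex.conj_conj x, ← h]
  simp

open Polynomial in
/-- If a polynomial in `T` kills `u`, the orbit of `u` spans together with `e` a finite dimensional
space; when this space is invariant under `M` and contains `e`, a polynomial in `M` kills `e`. -/
theorem exists_aeval_eq_zero_of_invariant {M T : H →L[ℂ] H} {e u : H} {q : ℂ[X]} (hq : q.Monic)
    (hqu : aeval T q u = 0) (hMe : ∃ p : ℂ[X], ∃ c : ℂ, M e = c • e + aeval T p u)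
    (hMu : ∀ p : ℂ[X], ∃ c : ℂ, M (aeval T p u) = c • e + T (aeval T p u)) :
    ∃ p : ℂ[X], p ≠ 0 ∧ aeval M p e = 0 := by
  let L : ℂ[X] →ₗ[ℂ] H :=
    { toFun := fun p => aeval T p u
      map_add' := fun p q => by rw [map_add]; rfl
      map_smul' := fun c p => by rw [map_smul]; rfl }
  have hL : ∀ p : ℂ[X], L p = aeval T p u := fun p => rfl
  let N₀ : Submodule ℂ H := (degreeLT ℂ q.natDegree).map L
  have hN₀ : ∀ p : ℂ[X], aeval T p u ∈ N₀ := by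
    intro p
    refine ⟨p %ₘ q, ?_, ?_⟩
    · rw [SetLike.mem_coe, mem_degreeLT, ← degree_eq_natDegree hq.ne_zero]
      exact degree_modByMonic_lt p hq
    · rw [hL]
      -- Division by `q` reduces every `p(T) u` to a polynomial of degree below that of `q`.
      nth_rewrite 2 [← modByMonic_add_div p q]
      rw [map_add, mul_comm, map_mul]
      change _ = aeval T (p %ₘ q) u + aeval T (p /ₘ q) (aeval T q u)
      rw [hqu, map_zero, add_zero]
  let N : Submodule ℂ H := Submodule.span ℂ {e} ⊔ N₀
  have hf₁ : FiniteDimensional ℂ (degreeLT ℂ q.natDegree) :=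
    (degreeLTEquiv ℂ q.natDegree).symm.finiteDimensional
  have hfin : FiniteDimensional ℂ N := inferInstance
  have heN : ∀ c : ℂ, c • e ∈ N := fun c =>
    Submodule.mem_sup_left (Submodule.smul_mem _ _ (Submodule.mem_span_singleton_self e))
  have hpN : ∀ p : ℂ[X], aeval T p u ∈ N := fun p => Submodule.mem_sup_right (hN₀ p)
  have hMN : ∀ y ∈ N, M y ∈ N := by
    intro y hy
    obtain ⟨y₁, hy₁, y₂, ⟨p, -, rfl⟩, rfl⟩ := Submodule.mem_sup.1 hy
    obtain ⟨c, rfl⟩ := Submodule.mem_span_singleton.1 hy₁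
    obtain ⟨p₀, c₀, h₀⟩ := hMe
    obtain ⟨c₁, h₁⟩ := hMu p
    rw [map_add, map_smul, h₀, hL, h₁]
    refine N.add_mem (N.smul_mem _ (N.add_mem (heN _) (hpN _))) (N.add_mem (heN _) ?_)
    have := hpN (X * p)
    rw [map_mul, aeval_X] at this
    exact this
  have hall : ∀ p : ℂ[X], aeval M p e ∈ N := by
    intro p
    induction p using Polynomial.induction_on with
    | C c =>
      rw [aeval_C, Algebra.algebraMap_eq_smul_one]
      exact heN c
    | add p q hp hq => rw [map_add]; exact N.add_mem hp hq
    | monomial n c ih =>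
      have : (C c * X ^ (n + 1) : ℂ[X]) = X * (C c * X ^ n) := by ring
      rw [this, map_mul, aeval_X]
      exact hMN _ ih
  by_contra! hcon
  let L' : ℂ[X] →ₗ[ℂ] N := LinearMap.codRestrict N
    { toFun := fun p => aeval M p e
      map_add' := fun p q => by rw [map_add]; rfl
      map_smul' := fun c p => by rw [map_smul]; rfl } hall
  have hinj : Function.Injective L' := by
    rw [← LinearMap.ker_eq_bot, LinearMap.ker_eq_bot']
    intro p hp
    by_contra hp0
    exact hcon p hp0 (congrArg Subtype.val hp)
  exact Polynomial.not_finite (R := ℂ) (FiniteDimensional.of_injective L' hinj)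

/-- The compression of `M` to the orthogonal complement of the unit vector `e`, extended to the
line through `e` as multiplication by `a`. -/
def compression (M : H →L[ℂ] H) (e : H) (a : ℝ) : H →L[ℂ] H :=
  let E : H →L[ℂ] H := (innerSL ℂ e).smulRight e
  (1 - E) ∘L M ∘L (1 - E) + (a : ℂ) • E

theorem compression_apply (M : H →L[ℂ] H) (e : H) (a : ℝ) (y : H) :
    compression M e a y = M (y - inner ℂ e y • e) - inner ℂ e (M (y - inner ℂ e y • e)) • e
      + ((a : ℂ) * inner ℂ e y) • e := by
  simp [compression, mul_smul]
  module

theorem compression_apply_of_inner_eq_zero (M : H →L[ℂ] H) {e y : H} (a : ℝ)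
    (hy : inner ℂ e y = 0) : compression M e a y = M y - inner ℂ e (M y) • e := by
  simp [compression_apply, hy]

theorem inner_compression_apply (M : H →L[ℂ] H) {e : H} (he : ‖e‖ = 1) (a : ℝ) (y : H) :
    inner ℂ e (compression M e a y) = a * inner ℂ e y := by
  rw [compression_apply]
  simp only [inner_add_right, inner_sub_right, inner_smul_right, inner_self_unit he]
  ring

theorem inner_compression (M : H →L[ℂ] H) (e : H) (a : ℝ) (x y : H) :
    inner ℂ x (compression M e a y) =
      inner ℂ (x - inner ℂ e x • e) (M (y - inner ℂ e y • e)) + a * (inner ℂ x e * inner ℂ e y) := by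
  rw [compression_apply]
  simp only [inner_add_right, inner_sub_right, inner_sub_left, inner_smul_right, inner_smul_left,
    inner_conj_symm]
  ring

theorem compression_bounds {M : H →L[ℂ] H} {e : H} (he : ‖e‖ = 1)
    {a b : ℝ} (hab : a ≤ b) (ha : ∀ y, a * ‖y‖ ^ 2 ≤ (inner ℂ y (M y)).re)
    (hb : ∀ y, (inner ℂ y (M y)).re ≤ b * ‖y‖ ^ 2) (y : H) :
    a * ‖y‖ ^ 2 ≤ (inner ℂ y (compression M e a y)).re ∧
      (inner ℂ y (compression M e a y)).re ≤ b * ‖y‖ ^ 2 := by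
  have h1 : (inner ℂ y (compression M e a y)).re =
      (inner ℂ (y - inner ℂ e y • e) (M (y - inner ℂ e y • e))).re + a * ‖inner ℂ e y‖ ^ 2 := by
    rw [inner_compression, ← inner_conj_symm y e, Complex.conj_mul']
    simp [← Complex.ofReal_pow]
  rw [h1, norm_sq_eq_of_unit he y]
  have := ha (y - inner ℂ e y • e)
  have := hb (y - inner ℂ e y • e)
  constructor <;> nlinarith [sq_nonneg ‖inner ℂ e y‖]

variable [CompleteSpace H]

theorem isSelfAdjoint_apply {M : H →L[ℂ] H} (hM : IsSelfAdjoint M) (x y : H) :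
    inner ℂ (M x) y = inner ℂ x (M y) := hM.isSymmetric x y

theorem compression_isSelfAdjoint {M : H →L[ℂ] H} (hM : IsSelfAdjoint M) (e : H)
    (a : ℝ) : IsSelfAdjoint (compression M e a) := by
  rw [ContinuousLinearMap.isSelfAdjoint_iff_isSymmetric]
  intro x y
  simp only [ContinuousLinearMap.coe_coe]
  rw [← inner_conj_symm, inner_compression, inner_compression, map_add, map_mul, map_mul,
    inner_conj_symm, inner_conj_symm, inner_conj_symm, Complex.conj_ofReal,
    isSelfAdjoint_apply hM]
  ring

theorem inner_conj_resolvent {M : H →L[ℂ] H} (hM : IsSelfAdjoint M) (x : ℂ) (u y : H) :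
    inner ℂ u (x • y - M y) = inner ℂ (starRingEnd ℂ x • u - M u) y := by
  rw [inner_sub_right, inner_sub_left, inner_smul_right, inner_smul_left, Complex.conj_conj,
    isSelfAdjoint_apply hM]

open Polynomial in
-- For `x` off `[a, b]` one finds `s` with `⟨e, s⟩ = 1` and `(x - M) s = c e`; then `c ⟨e, h x⟩ =
-- 1`, and pairing with `r` computes `c`.
theorem exists_next_measure_of_model {M : H →L[ℂ] H} (hM : IsSelfAdjoint M) {a b : ℝ} (hab : a ≤ b)
    (ha : ∀ y, a * ‖y‖ ^ 2 ≤ (inner ℂ y (M y)).re) (hb : ∀ y, (inner ℂ y (M y)).re ≤ b * ‖y‖ ^ 2)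
    {e : H} (he : ‖e‖ = 1) (hnd : ∀ p : ℂ[X], aeval M p e = 0 → p = 0)
    {h : ℂ → H} (hh : ∀ x ∉ complexIcc a b, x • h x - M (h x) = e)
    {w : ℂ} (hw : w ∉ complexIcc a b) (hφ : inner ℂ e (h w) ≠ (0 : ℂ))
    {A B : ℝ} (hB : B = ‖h w‖ ^ 2 / ‖(inner ℂ e (h w) : ℂ)‖ ^ 2)
    (hA : (A : ℂ) = inner ℂ (h w) (M (h w)) / (‖(inner ℂ e (h w) : ℂ)‖ : ℂ) ^ 2) :
    1 < B ∧ ∃ ρ : Measure ℝ, IsProbabilityMeasure ρ ∧ ρ (Set.Icc a b)ᶜ = 0 ∧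
      (∀ s : Finset ℝ, ρ (s : Set ℝ)ᶜ ≠ 0) ∧
      ∀ x ∉ complexIcc a b, inner ℂ e (h x) *
        (x * B - A - ((B - 1 : ℝ) : ℂ) * (x - w) * (x - starRingEnd ℂ w) * markovFun ρ x) = 1 := by
  generalize hφdef : (inner ℂ e (h w) : ℂ) = φ at *
  obtain ⟨r, hr⟩ : ∃ r : H, r = φ⁻¹ • h w := ⟨_, rfl⟩
  obtain ⟨k, hk⟩ : ∃ k : H, k = r - e := ⟨_, rfl⟩
  have hrek : r = e + k := by rw [hk]; abel
  have hee := inner_self_unit he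
  have her : inner ℂ e r = (1 : ℂ) := by
    rw [hr, inner_smul_right, hφdef, inv_mul_cancel₀ hφ]
  have hek : inner ℂ e k = (0 : ℂ) := by rw [hk, inner_sub_right, her, hee, sub_self]
  have hMr : M r = w • r - φ⁻¹ • e := by
    rw [hr, map_smul, ← hh w hw, smul_sub, smul_comm w φ⁻¹]
    abel
  -- If `k = 0`, then `e` is an eigenvector of `M` with eigenvalue `w - φ⁻¹`, a polynomial relation
  -- of degree one.
  have hk0 : k ≠ 0 := by
    intro h0
    have hre : r = e := by rw [hrek, h0, add_zero]
    have h1 : aeval M (X - C (w - φ⁻¹)) e = 0 := by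
      rw [map_sub, aeval_X, aeval_C, Algebra.algebraMap_eq_smul_one]
      change M e - (w - φ⁻¹) • e = 0
      rw [hre] at hMr
      rw [hMr]
      module
    exact X_sub_C_ne_zero _ (hnd _ h1)
  have hkn : 0 < ‖k‖ := norm_pos_iff.2 hk0
  have hB' : B = 1 + ‖k‖ ^ 2 := by
    have h1 : B = ‖r‖ ^ 2 := by
      rw [hB, hr, norm_smul, norm_inv, mul_pow, inv_pow, div_eq_inv_mul]
    rw [h1, norm_sq_eq_of_unit he r, her, one_smul, ← hk]
    simp [add_comm]
  have hBr : inner ℂ r r = (B : ℂ) := by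
    rw [inner_self_eq_ofReal_norm_sq, norm_sq_eq_of_unit he r, her, one_smul, ← hk, hB']
    simp [add_comm]
  have hAr : inner ℂ r (M r) = (A : ℂ) := by
    rw [hA, hr, map_smul, inner_smul_left, inner_smul_right, ← mul_assoc, map_inv₀, ← mul_inv,
      Complex.conj_mul', div_eq_inv_mul]
  -- Acting as the scalar `a` on the line of `e` keeps the spectrum of `T` inside `[a, b]`.
  obtain ⟨T, hTdef⟩ : ∃ T, T = compression M e a := ⟨_, rfl⟩
  have hT : IsSelfAdjoint T := hTdef ▸ compression_isSelfAdjoint hM e a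
  have hs : spectrum ℝ T ⊆ Set.Icc a b :=
    spectrum_subset_Icc_of_inner_bounds hT (fun y => hTdef ▸ (compression_bounds he hab ha hb y).1)
      (fun y => hTdef ▸ (compression_bounds he hab ha hb y).2)
  obtain ⟨u, hu⟩ : ∃ u : H, u = ((‖k‖⁻¹ : ℝ) : ℂ) • k := ⟨_, rfl⟩
  have hku : k = ((‖k‖ : ℝ) : ℂ) • u := by
    rw [hu, smul_smul, ← Complex.ofReal_mul, mul_inv_cancel₀ hkn.ne', Complex.ofReal_one, one_smul]
  have hun : ‖u‖ = 1 := by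
    rw [hu, norm_smul, Complex.norm_real, norm_inv, norm_norm, inv_mul_cancel₀ hkn.ne']
  have heu : inner ℂ e u = (0 : ℂ) := by rw [hu, inner_smul_right, hek, mul_zero]
  obtain ⟨ρ, hρp, hρ0, hρ⟩ := exists_spectralMeasure hT hab hs hun
  have hMT : ∀ y, inner ℂ e y = (0 : ℂ) → M y = (inner ℂ e (M y) : ℂ) • e + T y := by
    intro y hy
    rw [hTdef, compression_apply_of_inner_eq_zero M a hy]
    abel
  refine ⟨by rw [hB']; nlinarith, ρ, hρp, hρ0, ?_, ?_⟩
  · intro s hs0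
    let q : ℝ[X] := ∏ t ∈ s, (X - C t)
    -- The polynomial `q` vanishes on the supposed finite carrier, so `‖q(T) u‖² = ∫ q² dρ = 0`.
    have hq : q.Monic := monic_prod_of_monic _ _ fun t _ => monic_X_sub_C t
    have hqu : aeval T q u = 0 := by
      have h1 := norm_sq_aeval_apply hT hρ q
      have h2 : ∫ t, q.eval t ^ 2 ∂ρ = 0 := by
        refine integral_eq_zero_of_ae ?_
        have : ∀ᵐ t ∂ρ, t ∈ (s : Set ℝ) := by rw [ae_iff]; exact hs0
        filter_upwards [this] with t ht
        have : q.eval t = 0 := by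
          rw [eval_prod]
          exact Finset.prod_eq_zero ht (by simp)
        simp [this]
      rw [h2] at h1
      exact norm_eq_zero.1 (pow_eq_zero_iff two_ne_zero |>.1 h1)
    have hqu' : aeval T (q.map (algebraMap ℝ ℂ)) u = 0 := by
      rw [aeval_map_algebraMap]; exact hqu
    have hep : ∀ p : ℂ[X], inner ℂ e (aeval T p u) = (0 : ℂ) := by
      intro p
      induction p using Polynomial.induction_on with
      | C c =>
        rw [aeval_C, Algebra.algebraMap_eq_smul_one]
        change inner ℂ e (c • u) = (0 : ℂ)
        rw [inner_smul_right, heu, mul_zero]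
      | add p q hp hq =>
        rw [map_add]
        change inner ℂ e (aeval T p u + aeval T q u) = (0 : ℂ)
        rw [inner_add_right, hp, hq, add_zero]
      | monomial n c ih =>
        have : (C c * X ^ (n + 1) : ℂ[X]) = X * (C c * X ^ n) := by ring
        rw [this, map_mul, aeval_X]
        change inner ℂ e (T (aeval T (C c * X ^ n) u)) = (0 : ℂ)
        rw [hTdef, inner_compression_apply M he, ← hTdef, ih, mul_zero]
    obtain ⟨m, hMk⟩ : ∃ m : ℂ, M k = m • e + T k := ⟨_, hMT k hek⟩
    obtain ⟨p, hp, hp0⟩ := exists_aeval_eq_zero_of_invariant (M := M) (e := e)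
      (hq.map (algebraMap ℝ ℂ)) hqu'
      -- From `e = r - k`: `M e = (w - φ⁻¹ - m) e + (w - T) k`, where `k = ‖k‖ u`.
      ⟨C (‖k‖ : ℂ) * (C w - X), w - φ⁻¹ - m, by
        have h1 : M e = M r - M k := by rw [← map_sub, hrek, add_sub_cancel_right]
        rw [h1, hMr, hMk, hrek, map_mul, map_sub, aeval_X, aeval_C, aeval_C,
          Algebra.algebraMap_eq_smul_one, Algebra.algebraMap_eq_smul_one]
        change _ = _ + ((‖k‖ : ℝ) : ℂ) • (w • u - T u)
        have h2 : T k = ((‖k‖ : ℝ) : ℂ) • T u := by rw [← map_smul, ← hku]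
        rw [smul_sub, smul_comm _ w, ← hku, ← h2]
        module⟩
      fun p => ⟨_, hMT _ (hep p)⟩
    exact hp (hnd p hp0)
  · intro x hx
    obtain ⟨g', hg', hgm⟩ := exists_resolvent_apply hT hs hρ0 hρ hx
    obtain ⟨g, hg⟩ : ∃ g : H, g = ((‖k‖ : ℝ) : ℂ) • g' := ⟨_, rfl⟩
    have hgk : x • g - T g = k := by
      rw [hg, map_smul, smul_comm, ← smul_sub, hg', ← hku]
    have hkg : inner ℂ k g = ((‖k‖ ^ 2 : ℝ) : ℂ) * markovFun ρ x := by
      rw [hku, hg, inner_smul_left, inner_smul_right, hgm, Complex.conj_ofReal, norm_smul, hun]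
      simp
      ring
    have heg : inner ℂ e g = (0 : ℂ) := by
      have h1 := congrArg (fun y => (inner ℂ e y : ℂ)) hgk
      simp only [inner_sub_right, inner_smul_right, hek] at h1
      rw [hTdef, inner_compression_apply M he, ← sub_mul] at h1
      exact (mul_eq_zero.1 h1).resolve_left
        (sub_ofReal_ne_zero hx ⟨le_rfl, hab⟩)
    -- The coefficient `w - x` cancels the `k` component of `(x - M) r = (x - w)(e + k) + φ⁻¹ e`,
    -- since `(x - M) g = k - m e`.
    obtain ⟨s, hs'⟩ : ∃ s : H, s = r + (w - x) • g := ⟨_, rfl⟩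
    obtain ⟨m, hm⟩ : ∃ m : ℂ, m = inner ℂ e (M g) := ⟨_, rfl⟩
    obtain ⟨c, hc⟩ : ∃ c : ℂ, c = (x - w) + φ⁻¹ - (w - x) * m := ⟨_, rfl⟩
    have hxg : x • g - M g = k - m • e := by
      rw [hMT g heg, ← hgk, ← hm]
      abel
    have hxs : x • s - M s = c • e := by
      have : x • s - M s = (x • r - M r) + (w - x) • (x • g - M g) := by
        rw [hs', map_add, map_smul]
        module
      rw [this, hMr, hxg, hrek, hc]
      module
    have hes : inner ℂ e s = (1 : ℂ) := by
      rw [hs', inner_add_right, inner_smul_right, heg, her]; simp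
    -- Pairing with `h (conj x)` inverts `x - M` weakly; applied to `h x` and to `s`, it gives `c
    -- ⟨e, h x⟩ = 1`.
    have hpair : ∀ y, inner ℂ (h (starRingEnd ℂ x)) (x • y - M y) = (inner ℂ e y : ℂ) := fun y => by
      rw [inner_conj_resolvent hM, hh _ (conj_notMem_complexIcc hx)]
    have h1 : c * inner ℂ e (h x) = 1 := by
      have e1 := hpair (h x)
      have e2 := hpair s
      rw [hh x hx] at e1
      rw [hxs, inner_smul_right, e1, hes] at e2
      exact e2
    have hre : inner ℂ r e = (1 : ℂ) := by
      rw [← inner_conj_symm, her, map_one]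
    have hrg : inner ℂ r (x • g - M g) = (x - starRingEnd ℂ w) * inner ℂ k g := by
      rw [inner_conj_resolvent hM, hMr]
      have : starRingEnd ℂ x • r - (w • r - φ⁻¹ • e) = (starRingEnd ℂ x - w) • r + φ⁻¹ • e := by
        module
      rw [this, inner_add_left, inner_smul_left, inner_smul_left, heg, hrek, inner_add_left, heg]
      simp
    have h2 : c = x * B - A + (w - x) * ((x - starRingEnd ℂ w) * inner ℂ k g) := by
      have e1 : inner ℂ r (x • s - M s) = c := by
        rw [hxs, inner_smul_right, hre, mul_one]
      have e2 : x • s - M s = x • r - M r + (w - x) • (x • g - M g) := by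
        rw [hs', map_add, map_smul]
        module
      rw [← e1, e2, inner_add_right, inner_sub_right, inner_smul_right, inner_smul_right, hBr, hAr,
        hrg]
    rw [← h1, h2, hkg, hB']
    push_cast
    ring

end Step
-- Iteration of the step.
section Sequence

/-- Probability measures carried by `[a, b]` but by no finite set. -/
def IsInfinitelyCarried (a b : ℝ) (ν : Measure ℝ) : Prop :=
  IsProbabilityMeasure ν ∧ ν (Set.Icc a b)ᶜ = 0 ∧ ∀ s : Finset ℝ, ν (s : Set ℝ)ᶜ ≠ 0

theorem IsInfinitelyCarried.exists_next {a b : ℝ} (hab : a ≤ b) {ν : Measure ℝ}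
    (h : IsInfinitelyCarried a b ν) {w : ℂ} (hw : w ∉ complexIcc a b) :
    1 < thieleB ν w ∧ ∃ ρ : Measure ℝ, IsInfinitelyCarried a b ρ ∧ ∀ x ∉ complexIcc a b,
      markovFun ν x = 1 / (x * (thieleB ν w : ℂ) - (thieleA ν w : ℂ)
        - ((√(thieleB ν w - 1) : ℝ) : ℂ) ^ 2 * (x - w) * (x - starRingEnd ℂ w)
          * markovFun ρ x) := by
  obtain ⟨hp, hν, hfin⟩ := h
  obtain ⟨M, e, h, hM, ha, hb, he, hh, hp⟩ := exists_multiplication_model hν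
  have hnd : ∀ p : Polynomial ℂ, Polynomial.aeval M p e = 0 → p = 0 := by
    intro p hpe
    by_contra hp0
    refine hfin (p.roots.toFinset.preimage Complex.ofReal Complex.ofReal_injective.injOn) ?_
    refine measure_mono_null ?_ (ae_iff.1 (hp p hpe))
    intro t ht h0
    apply ht
    simpa [hp0] using h0
  have hφ := (hh w hw).2.1
  obtain ⟨hB, ρ, hρp, hρ, hρf, hρm⟩ := exists_next_measure_of_model hM hab ha hb he hnd
    (fun x hx => (hh x hx).1) hw (by rw [hφ]; exact markovFun_ne_zero hab hν hw)
    (B := thieleB ν w) (A := thieleA ν w) (by rw [hφ, (hh w hw).2.2.1, thieleB])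
    (by rw [hφ, (hh w hw).2.2.2, thieleA]; push_cast; rfl)
  refine ⟨hB, ρ, ⟨hρp, hρ, hρf⟩, fun x hx => ?_⟩
  have h1 := hρm x hx
  rw [(hh x hx).2.1] at h1
  rw [← Complex.ofReal_pow, Real.sq_sqrt (by linarith)]
  exact eq_one_div_of_mul_eq_one_left h1

/-- The recursion runs over measures with no finite carrier, a property that each step preserves and
that makes `B_{j,j} > 1` strict. -/
theorem exists_isThieleSequence {a b : ℝ} (hab : a ≤ b) {μ : Measure ℝ}
    (hμ : IsInfinitelyCarried a b μ) {z : ℕ → ℂ}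
    (hconj : ∀ j : ℕ, z (2 * j + 1) = starRingEnd ℂ (z (2 * j + 2)))
    (hz : ∀ j : ℕ, z (2 * j + 1) ∉ complexIcc a b) :
    ∃ ν : ℕ → Measure ℝ, IsThieleSequence a b z μ ν ∧ ∀ j, 1 < diagB z ν j := by
  choose hB next hnext hstep using
    fun (j : ℕ) (ν : {ν // IsInfinitelyCarried a b ν}) => ν.2.exists_next hab (hz j)
  let ν : ℕ → {ν // IsInfinitelyCarried a b ν} := fun n =>
    Nat.rec ⟨μ, hμ⟩ (fun j ν => ⟨next j ν, hnext j ν⟩) n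
  refine ⟨fun n => (ν n).1, ⟨rfl, fun j => (ν j).2.1, fun j => (ν j).2.2.1, fun j x hx => ?_⟩,
    fun j => hB j (ν j)⟩
  have h1 := hstep j (ν j) x hx
  rw [hconj j, Complex.conj_conj, ← hconj j] at h1
  exact h1

theorem isInfinitelyCarried_of_infinite_support {a b : ℝ} {μ : Measure ℝ}
    (hμ : IsProbabilityMeasure μ) (hab : μ (Set.Icc a b)ᶜ = 0) (hinf : μ.support.Infinite) :
    IsInfinitelyCarried a b μ := by
  refine ⟨hμ, hab, fun s hs => hinf (s.finite_toSet.subset ?_)⟩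
  exact Measure.support_subset_of_isClosed s.finite_toSet.isClosed (mem_ae_iff.2 hs)

end Sequence
-- Bounded Hermitian tridiagonal operators and their quadratic forms.
section Jacobi

/-- Injectivity of `σ` is asked only where the weight is nonzero, so that the truncated shift `j ↦ j
- 1`, which takes the value `0` twice, is allowed with weight `0` at `j = 0`. -/
theorem exists_weighted_composition (c : ℕ → ℂ) (C : ℝ) (hc : ∀ j, ‖c j‖ ≤ C) (σ : ℕ → ℕ)
    (hσ : Set.InjOn σ {j | c j ≠ 0}) :
    ∃ T : SeqL2 →L[ℂ] SeqL2, ∀ (y : SeqL2) (j : ℕ), T y j = c j * y (σ j) := by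
  have hC : 0 ≤ C := (norm_nonneg _).trans (hc 0)
  have key : ∀ (y : SeqL2) (s : Finset ℕ),
      ∑ j ∈ s, ‖c j * y (σ j)‖ ^ (2 : ENNReal).toReal ≤ (C * ‖y‖) ^ (2 : ENNReal).toReal := by
    intro y s
    have h2 : (2 : ENNReal).toReal = 2 := by simp
    have h1 : ∀ j ∈ s, c j ≠ 0 ∨ ‖c j * y (σ j)‖ ^ (2 : ENNReal).toReal = 0 := by
      intro j _
      by_cases h : c j = 0
      · right; simp [h]
      · exact Or.inl h
    have h3 : ∑ j ∈ s with c j ≠ 0, ‖c j * y (σ j)‖ ^ (2 : ENNReal).toReal =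
        ∑ j ∈ s, ‖c j * y (σ j)‖ ^ (2 : ENNReal).toReal :=
      Finset.sum_filter_of_ne fun j hj hne => (h1 j hj).resolve_right hne
    rw [← h3]
    calc ∑ j ∈ s with c j ≠ 0, ‖c j * y (σ j)‖ ^ (2 : ENNReal).toReal
        ≤ ∑ j ∈ s with c j ≠ 0, C ^ (2 : ENNReal).toReal * ‖y (σ j)‖ ^ (2 : ENNReal).toReal := by
          refine Finset.sum_le_sum fun j _ => ?_
          rw [← Real.mul_rpow hC (norm_nonneg _), norm_mul]
          gcongr
          exact hc j
      _ = C ^ (2 : ENNReal).toReal * ∑ i ∈ (s.filter fun j => c j ≠ 0).image σ,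
            ‖y i‖ ^ (2 : ENNReal).toReal := by
          rw [← Finset.mul_sum, Finset.sum_image]
          intro i hi j hj h
          exact hσ (by simpa using (Finset.mem_filter.1 hi).2)
            (by simpa using (Finset.mem_filter.1 hj).2) h
      _ ≤ C ^ (2 : ENNReal).toReal * ‖y‖ ^ (2 : ENNReal).toReal := by
          gcongr
          exact lp.sum_rpow_le_norm_rpow (by simp) y _
      _ = _ := (Real.mul_rpow hC (norm_nonneg _)).symm
  have hmem : ∀ y : SeqL2, Memℓp (fun j => c j * y (σ j)) 2 := fun y => memℓp_gen' (key y)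
  let L : SeqL2 →ₗ[ℂ] SeqL2 :=
    { toFun := fun y => ⟨fun j => c j * y (σ j), hmem y⟩
      map_add' := fun x y => by
        ext j
        change c j * (x (σ j) + y (σ j)) = c j * x (σ j) + c j * y (σ j)
        ring
      map_smul' := fun r y => by
        ext j
        change c j * (r * y (σ j)) = r * (c j * y (σ j))
        ring }
  exact ⟨L.mkContinuous C fun y => lp.norm_le_of_forall_sum_le (by simp)
    (mul_nonneg hC (norm_nonneg _)) (key y), fun y j => rfl⟩

/-- The Hermitian tridiagonal matrix with diagonal `d` and superdiagonal `c`. -/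
def jacobiMatrix (d : ℕ → ℝ) (c : ℕ → ℂ) : Matrix ℕ ℕ ℂ := fun j k =>
  if j = k then (d j : ℂ)
  else if j = k + 1 then starRingEnd ℂ (c k)
  else if k = j + 1 then c j
  else 0

/-- The quadratic form of the leading `(N + 1) × (N + 1)` section of `jacobiMatrix d c`. -/
def jacobiForm (d : ℕ → ℝ) (c : ℕ → ℂ) (y : ℕ → ℂ) (N : ℕ) : ℝ :=
  ∑ j ∈ Finset.range (N + 1), d j * ‖y j‖ ^ 2 +
    ∑ j ∈ Finset.range N, 2 * (starRingEnd ℂ (y j) * (c j * y (j + 1))).re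

theorem jacobiForm_succ (d : ℕ → ℝ) (c : ℕ → ℂ) (y : ℕ → ℂ) (N : ℕ) :
    jacobiForm d c y (N + 1) = jacobiForm d c y N + d (N + 1) * ‖y (N + 1)‖ ^ 2 +
      2 * (starRingEnd ℂ (y N) * (c N * y (N + 1))).re := by
  simp only [jacobiForm, Finset.sum_range_succ _ (N + 1), Finset.sum_range_succ _ N]
  ring

/-- Completing squares: the form is `q k * ‖y k‖ ^ 2`, plus terms at least `(‖c j‖ ‖y j‖ - q (j+1)
‖y (j+1)‖)² / q (j+1)`, plus a nonnegative remainder at the last index. -/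
theorem le_jacobiForm {d : ℕ → ℝ} {c : ℕ → ℂ} {q : ℕ → ℝ} (hq : ∀ j, 0 < q j)
    (hd : ∀ j, d j = q j + ‖c j‖ ^ 2 / q (j + 1)) {y : ℕ → ℂ} {k : ℕ} (hy : ∀ i < k, y i = 0)
    {N : ℕ} (hN : k ≤ N) : q k * ‖y k‖ ^ 2 ≤ jacobiForm d c y N := by
  -- The part of `d N` not yet used is kept, since the next square consumes it.
  suffices h : q k * ‖y k‖ ^ 2 + ‖c N‖ ^ 2 / q (N + 1) * ‖y N‖ ^ 2 ≤ jacobiForm d c y N by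
    have : 0 ≤ ‖c N‖ ^ 2 / q (N + 1) * ‖y N‖ ^ 2 := by have := hq (N + 1); positivity
    linarith
  induction N, hN using Nat.le_induction with
  | base =>
    have h1 : ∑ j ∈ Finset.range (k + 1), d j * ‖y j‖ ^ 2 = d k * ‖y k‖ ^ 2 := by
      rw [Finset.sum_range_succ, Finset.sum_eq_zero, zero_add]
      intro j hj
      rw [hy j (Finset.mem_range.1 hj)]; simp
    have h2 : ∑ j ∈ Finset.range k, 2 * (starRingEnd ℂ (y j) * (c j * y (j + 1))).re = 0 := by
      refine Finset.sum_eq_zero fun j hj => ?_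
      rw [hy j (Finset.mem_range.1 hj)]; simp
    rw [jacobiForm, h1, h2, hd]
    linarith
  | succ N hN ih =>
    rw [jacobiForm_succ, hd]
    have h1 : -(‖y N‖ * (‖c N‖ * ‖y (N + 1)‖)) ≤
        (starRingEnd ℂ (y N) * (c N * y (N + 1))).re := by
      have := Complex.abs_re_le_norm (starRingEnd ℂ (y N) * (c N * y (N + 1)))
      rw [norm_mul, norm_mul, RCLike.norm_conj] at this
      exact (abs_le.1 this).1
    have hqN := hq (N + 1)
    have h2 : 0 ≤ (‖c N‖ * ‖y N‖ - q (N + 1) * ‖y (N + 1)‖) ^ 2 / q (N + 1) := by positivity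
    have h3 : (‖c N‖ * ‖y N‖ - q (N + 1) * ‖y (N + 1)‖) ^ 2 / q (N + 1) =
        ‖c N‖ ^ 2 / q (N + 1) * ‖y N‖ ^ 2 + q (N + 1) * ‖y (N + 1)‖ ^ 2 -
          2 * (‖y N‖ * (‖c N‖ * ‖y (N + 1)‖)) := by
      field_simp; ring
    linarith

/-- The operator is a diagonal `D` plus weighted shifts `U` and `V` with `⟨y, V y⟩` conjugate to
`⟨y, U y⟩`; this makes the form real and the limit of its finite sections. -/
theorem exists_jacobi_operator (d : ℕ → ℝ) (c : ℕ → ℂ) (C : ℝ) (hd : ∀ j, |d j| ≤ C)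
    (hc : ∀ j, ‖c j‖ ≤ C) :
    ∃ T : SeqL2 →L[ℂ] SeqL2, ActsAsMatrix T (jacobiMatrix d c) ∧
      ∀ y : SeqL2, (inner ℂ y (T y)).im = 0 ∧
        Filter.Tendsto (jacobiForm d c y) Filter.atTop (nhds (inner ℂ y (T y)).re) := by
  have hC : 0 ≤ C := (abs_nonneg _).trans (hd 0)
  obtain ⟨D, hD⟩ := exists_weighted_composition (fun j => (d j : ℂ)) C (by simpa using hd) id
    Function.injective_id.injOn
  obtain ⟨U, hU⟩ := exists_weighted_composition c C hc (fun j => j + 1)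
    (add_left_injective 1).injOn
  obtain ⟨V, hV⟩ := exists_weighted_composition
    (fun j => if j = 0 then 0 else starRingEnd ℂ (c (j - 1))) C
    (fun j => by split_ifs <;> simp [hC, hc]) (fun j => j - 1)
    (fun i hi j hj h => by
      have hi' : i ≠ 0 := fun h0 => hi (by simp [h0])
      have hj' : j ≠ 0 := fun h0 => hj (by simp [h0])
      simp only at h
      omega)
  have happ : ∀ (y : SeqL2) (j : ℕ), (D + U + V) y j = D y j + U y j + V y j := fun y j => rfl
  refine ⟨D + U + V, ?_, ?_⟩
  · intro y j
    rw [happ, hD, hU, hV]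
    rcases j with _ | j
    · have h : HasSum (fun k => jacobiMatrix d c 0 k * y k)
          (∑ k ∈ {0, 1}, jacobiMatrix d c 0 k * y k) := hasSum_sum_of_ne_finset_zero ?_
      · simpa [jacobiMatrix] using h
      · intro k hk
        have : k ≠ 0 ∧ k ≠ 1 := by simpa using hk
        have h0 : ¬ (0 = k) := by omega
        simp [jacobiMatrix, h0, this.2]
    · have h : HasSum (fun k => jacobiMatrix d c (j + 1) k * y k)
          (∑ k ∈ {j, j + 1, j + 2}, jacobiMatrix d c (j + 1) k * y k) :=
        hasSum_sum_of_ne_finset_zero ?_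
      · have e : ∑ k ∈ {j, j + 1, j + 2}, jacobiMatrix d c (j + 1) k * y k =
            d (j + 1) * y (id (j + 1)) + c (j + 1) * y (j + 1 + 1) +
              (if j + 1 = 0 then 0 else starRingEnd ℂ (c (j + 1 - 1))) * y (j + 1 - 1) := by
          simp [jacobiMatrix]
          ring
        rw [e] at h
        exact h
      · intro k hk
        have : k ≠ j ∧ k ≠ j + 1 ∧ k ≠ j + 2 := by simpa using hk
        have h0 : ¬ (j + 1 = k) := by omega
        have h1 : ¬ (j = k) := by omega
        have h2 : ¬ (k = j + 1 + 1) := by omega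
        simp [jacobiMatrix, h0, h1, h2]
  · intro y
    have hcongr : ∀ {f g : ℕ → ℂ} {v : ℂ}, HasSum f v → (∀ j, f j = g j) → HasSum g v :=
      fun h e => funext e ▸ h
    have sD : HasSum (fun j => ((d j * ‖y j‖ ^ 2 : ℝ) : ℂ)) (inner ℂ y (D y)) := by
      refine hcongr (lp.hasSum_inner (𝕜 := ℂ) y (D y)) fun j => ?_
      rw [hD, ← smul_eq_mul, inner_smul_right, id, inner_self_eq_ofReal_norm_sq]
      push_cast; rfl
    have sU : HasSum (fun j => starRingEnd ℂ (y j) * (c j * y (j + 1))) (inner ℂ y (U y)) := by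
      refine hcongr (lp.hasSum_inner (𝕜 := ℂ) y (U y)) fun j => ?_
      rw [hU]
      exact mul_comm _ _
    have sV : HasSum (fun j => starRingEnd ℂ (starRingEnd ℂ (y j) * (c j * y (j + 1))))
        (inner ℂ y (V y)) := by
      have := lp.hasSum_inner (𝕜 := ℂ) y (V y)
      have h0 : inner ℂ (y 0) (V y 0) = (0 : ℂ) := by rw [hV]; simp
      rw [← hasSum_nat_add_iff' 1, Finset.sum_range_one, h0, sub_zero] at this
      refine hcongr this fun j => ?_
      rw [hV]
      change ((if j + 1 = 0 then 0 else starRingEnd ℂ (c j)) * y j) * starRingEnd ℂ (y (j + 1)) = _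
      rw [if_neg (Nat.succ_ne_zero j), map_mul, map_mul, Complex.conj_conj]
      ring
    have hVU : inner ℂ y (V y) = starRingEnd ℂ (inner ℂ y (U y)) :=
      sV.unique (Complex.hasSum_conj'.2 (by simpa using sU))
    have hreal : inner ℂ y ((D + U + V) y) = inner ℂ y (D y) +
        ((2 * (inner ℂ y (U y)).re : ℝ) : ℂ) := by
      change inner ℂ y (D y + U y + V y) = _
      rw [inner_add_right, inner_add_right, hVU, add_assoc, Complex.add_conj]
    have hDre : inner ℂ y (D y) = (((inner ℂ y (D y)).re : ℝ) : ℂ) := by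
      have h1 := Complex.hasSum_re sD
      simp only [Complex.ofReal_re] at h1
      exact sD.unique (Complex.hasSum_ofReal.2 h1)
    rw [hreal, hDre]
    refine ⟨by simp, ?_⟩
    -- A section has one more diagonal term than off-diagonal terms, hence the shifted index.
    have t1 := ((Complex.hasSum_re sD).tendsto_sum_nat).comp (Filter.tendsto_add_atTop_nat 1)
    have t2 := ((Complex.hasSum_re sU).mul_left 2).tendsto_sum_nat
    have := t1.add t2
    simp only [Complex.ofReal_re] at this
    simp only [Complex.add_re, Complex.ofReal_re]
    exact this

end Jacobi

/-! ### Sign of the pencil at real points off the interval. -/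

theorem markovFun_ofReal {ν : Measure ℝ} (x : ℝ) :
    markovFun ν x = ((∫ t, 1 / (x - t) ∂ν : ℝ) : ℂ) := by
  rw [markovFun, ← integral_complex_ofReal]
  congr 1
  ext t
  push_cast; rfl

/-- Strictness comes from the Markov function having no zero off `[a, b]`. -/
theorem integral_sign_pos {ν : Measure ℝ} [IsProbabilityMeasure ν] {a b : ℝ} (hab : a ≤ b)
    (hν : ν (Set.Icc a b)ᶜ = 0) {x s : ℝ} (hx : (x : ℂ) ∉ complexIcc a b)
    (hs : ∀ t ∈ Set.Icc a b, 0 ≤ s * (1 / (x - t))) (hs0 : s ≠ 0) :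
    0 < s * ∫ t, 1 / (x - t) ∂ν := by
  have h0 : ∫ t, 1 / (x - t) ∂ν ≠ 0 := by
    have := markovFun_ne_zero hab hν hx
    rw [markovFun_ofReal] at this
    exact_mod_cast this
  refine lt_of_le_of_ne ?_ (mul_ne_zero hs0 h0).symm
  rw [← integral_const_mul]
  exact integral_nonneg_of_ae ((ae_mem_Icc hν).mono hs)

section Pencil

variable {a b : ℝ} {z : ℕ → ℂ} {μ : Measure ℝ} {ν : ℕ → Measure ℝ}

theorem offB_sq (hab : a ≤ b) (hz : ∀ j : ℕ, z (2 * j + 1) ∉ complexIcc a b)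
    (hν : IsThieleSequence a b z μ ν) (j : ℕ) : offB z ν j ^ 2 = diagB z ν j - 1 := by
  have := hν.prob j
  exact Real.sq_sqrt (sub_nonneg.2 (one_le_thieleB hab (hν.carried j) (hz j)))

/-- The continued fraction step solved for its diagonal term; at real `x` the product `(x -
z_{2j+1})(x - z_{2j+2})` is `|x - z_{2j+2}|²`. This is the shape required by `le_jacobiForm`. -/
theorem diag_pencil_eq (hab : a ≤ b)
    (hconj : ∀ j : ℕ, z (2 * j + 1) = starRingEnd ℂ (z (2 * j + 2)))
    (hν : IsThieleSequence a b z μ ν) {x : ℝ} (hx : (x : ℂ) ∉ complexIcc a b) (j : ℕ) :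
    x * diagB z ν j - diagA z ν j = 1 / (∫ t, 1 / (x - t) ∂(ν j)) +
      ‖(offB z ν j : ℂ) * (x - z (2 * j + 2))‖ ^ 2 * ∫ t, 1 / (x - t) ∂(ν (j + 1)) := by
  have := hν.prob j
  have h := hν.step j x hx
  have h0 := markovFun_ne_zero hab (hν.carried j) hx
  rw [markovFun_ofReal, markovFun_ofReal] at h
  rw [markovFun_ofReal] at h0
  have h1 := congrArg (fun c : ℂ => 1 / c) h
  simp only [one_div_one_div] at h1
  have h2 : ((x : ℂ) - z (2 * j + 1)) * (x - z (2 * j + 2)) =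
      ((‖(x : ℂ) - z (2 * j + 2)‖ ^ 2 : ℝ) : ℂ) := by
    rw [hconj j, Complex.ofReal_pow, ← Complex.conj_mul', map_sub, Complex.conj_ofReal]
  rw [mul_assoc _ ((x : ℂ) - z (2 * j + 1)), h2] at h1
  rw [norm_mul, mul_pow, Complex.norm_real, Real.norm_eq_abs, sq_abs]
  have h3 : (1 / (∫ t, 1 / (x - t) ∂(ν j)) : ℝ) = x * diagB z ν j - diagA z ν j -
      offB z ν j ^ 2 * ‖(x : ℂ) - z (2 * j + 2)‖ ^ 2 * ∫ t, 1 / (x - t) ∂(ν (j + 1)) := by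
    exact_mod_cast h1
  rw [h3]
  ring

/-- The sign `s = ±1` is that of all `φ_j(x)`, and `le_jacobiForm` applies with `q j = 1 / (s
φ_j(x))`. -/
theorem jacobiForm_pencil_nonneg (hab : a ≤ b)
    (hconj : ∀ j : ℕ, z (2 * j + 1) = starRingEnd ℂ (z (2 * j + 2)))
    (hν : IsThieleSequence a b z μ ν) {x s : ℝ} (hx : (x : ℂ) ∉ complexIcc a b)
    (hs : ∀ t ∈ Set.Icc a b, 0 ≤ s * (1 / (x - t))) (hs1 : s ^ 2 = 1) (y : ℕ → ℂ) (N : ℕ) :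
    0 ≤ s * (x * jacobiForm (diagB z ν) (fun j => (offB z ν j : ℂ)) y N -
      jacobiForm (diagA z ν) (fun j => (offB z ν j : ℂ) * z (2 * j + 2)) y N) := by
  have hs0 : s ≠ 0 := fun h => by simp [h] at hs1
  have hlin : s * (x * jacobiForm (diagB z ν) (fun j => (offB z ν j : ℂ)) y N -
      jacobiForm (diagA z ν) (fun j => (offB z ν j : ℂ) * z (2 * j + 2)) y N) =
      jacobiForm (fun j => s * (x * diagB z ν j - diagA z ν j))
        (fun j => (s : ℂ) * ((offB z ν j : ℂ) * (x - z (2 * j + 2)))) y N := by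
    simp only [jacobiForm]
    rw [mul_add, add_sub_add_comm, mul_add, Finset.mul_sum, Finset.mul_sum,
      ← Finset.sum_sub_distrib, ← Finset.sum_sub_distrib, Finset.mul_sum, Finset.mul_sum]
    congr 1 <;> refine Finset.sum_congr rfl fun j _ => ?_
    · ring
    · have : starRingEnd ℂ (y j) * (s * (offB z ν j * (x - z (2 * j + 2))) * y (j + 1)) =
          (s : ℂ) * (x * (starRingEnd ℂ (y j) * (offB z ν j * y (j + 1))) -
            starRingEnd ℂ (y j) * (offB z ν j * z (2 * j + 2) * y (j + 1))) := by ring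
      rw [this, Complex.re_ofReal_mul, Complex.sub_re, Complex.re_ofReal_mul]
      ring
  rw [hlin]
  have hpos : ∀ j, 0 < s * ∫ t, 1 / (x - t) ∂(ν j) := fun j => by
    have := hν.prob j
    exact integral_sign_pos hab (hν.carried j) hx hs hs0
  have := le_jacobiForm (c := fun j => (s : ℂ) * ((offB z ν j : ℂ) * (x - z (2 * j + 2))))
    (d := fun j => s * (x * diagB z ν j - diagA z ν j))
    (q := fun j => 1 / (s * ∫ t, 1 / (x - t) ∂(ν j))) (fun j => one_div_pos.2 (hpos j))
    (fun j => by
      have h1 : ‖(s : ℂ) * ((offB z ν j : ℂ) * (x - z (2 * j + 2)))‖ ^ 2 =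
          ‖(offB z ν j : ℂ) * (x - z (2 * j + 2))‖ ^ 2 := by
        rw [norm_mul, mul_pow, Complex.norm_real, Real.norm_eq_abs, sq_abs, hs1, one_mul]
      have h2 : 1 / s = s := by rw [div_eq_iff hs0, ← pow_two, hs1]
      rw [diag_pencil_eq hab hconj hν hx j, h1, div_div_eq_mul_div, div_one,
        one_div (s * _), mul_inv, ← one_div s, h2]
      ring) (y := y) (k := 0) (by simp) (Nat.zero_le N)
  exact le_trans (by have := one_div_pos.2 (hpos 0); positivity) this

theorem matB_eq_jacobiMatrix (z : ℕ → ℂ) (ν : ℕ → Measure ℝ) :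
    matB z ν = jacobiMatrix (diagB z ν) (fun j => (offB z ν j : ℂ)) := by
  ext j k
  simp [matB, jacobiMatrix]

theorem matA_eq_jacobiMatrix
    (hconj : ∀ j : ℕ, z (2 * j + 1) = starRingEnd ℂ (z (2 * j + 2))) (ν : ℕ → Measure ℝ) :
    matA z ν = jacobiMatrix (diagA z ν) (fun j => (offB z ν j : ℂ) * z (2 * j + 2)) := by
  ext j k
  simp [matA, jacobiMatrix, hconj]

theorem le_div_of_forall_lt_mul_le {a α β : ℝ} (hβ : 0 < β) (h : ∀ x < a, x * β ≤ α) :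
    a ≤ α / β :=
  le_of_forall_lt_imp_le_of_dense fun x hx => (le_div_iff₀ hβ).2 (h x hx)

theorem div_le_of_forall_lt_mul_le {b α β : ℝ} (hβ : 0 < β) (h : ∀ x, b < x → α ≤ x * β) :
    α / β ≤ b :=
  le_of_forall_gt_imp_ge_of_dense fun x hx => (div_le_iff₀ hβ).2 (h x hx)

theorem ofReal_notMem_complexIcc {x : ℝ} (hx : x ∉ Set.Icc a b) : (x : ℂ) ∉ complexIcc a b := by
  rintro ⟨t, ht, h⟩
  rw [← Complex.ofReal_injective h] at hx
  exact hx ht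

end Pencil
end

/-! ### The main theorem. -/

theorem proposition5p3 (a b : ℝ) (μ : Measure ℝ) (hμ : IsProbabilityMeasure μ)
    (hab : μ (Set.Icc a b)ᶜ = 0) (hinf : μ.support.Infinite)
    (z : ℕ → ℂ) (δ : ℝ) (hδ : 0 < δ)
    (hconj : ∀ j : ℕ, z (2 * j + 1) = starRingEnd ℂ (z (2 * j + 2)))
    (hdist : ∀ n : ℕ, 1 ≤ n → δ < Metric.infDist (z n) (complexIcc a b)) :
    (∃ ν : ℕ → Measure ℝ, IsThieleSequence a b z μ ν ∧ ∀ j, 1 < diagB z ν j) ∧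
    ∀ ν : ℕ → Measure ℝ, IsThieleSequence a b z μ ν →
      ∃ A B : SeqL2 →L[ℂ] SeqL2,
        ActsAsMatrix A (matA z ν) ∧ ActsAsMatrix B (matB z ν) ∧
        (∀ (y : SeqL2) (k : ℕ), (∀ i < k, y i = 0) →
          (inner ℂ y (B y)).im = 0 ∧ ‖y k‖ ^ 2 ≤ (inner ℂ y (B y)).re) ∧
        pencilNumericalRange A B ⊆ complexIcc a b := by
  have hle : a ≤ b := by
    by_contra h
    rw [Set.Icc_eq_empty h, Set.compl_empty, measure_univ] at hab
    exact one_ne_zero hab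
  have hz : ∀ j : ℕ, z (2 * j + 1) ∉ complexIcc a b := fun j h => by
    have := hdist (2 * j + 1) (by omega)
    rw [Metric.infDist_zero_of_mem h] at this
    linarith
  refine ⟨exists_isThieleSequence hle (isInfinitelyCarried_of_infinite_support hμ hab hinf)
    hconj hz, fun ν hν => ?_⟩
  set K : ℝ := 1 + (b - a) / δ
  set m : ℝ := max |a| |b|
  have hK : 0 ≤ K := by have : 0 ≤ b - a := by linarith
                        positivity
  have hbd := fun j => by
    have := hν.prob j
    exact thiele_bounds hle (hν.carried j) hδ (hdist (2 * j + 1) (by omega))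
  have hB1 : ∀ j, 1 ≤ diagB z ν j := fun j => by
    have := hν.prob j
    exact one_le_thieleB hle (hν.carried j) (hz j)
  have hoff : ∀ j, |offB z ν j| = offB z ν j := fun j => abs_of_nonneg (Real.sqrt_nonneg _)
  obtain ⟨A, hA, hAform⟩ := exists_jacobi_operator (diagA z ν)
    (fun j => (offB z ν j : ℂ) * z (2 * j + 2))
    (max (m * K ^ 2) ((m / δ + 1) * (b - a) * K))
    (fun j => le_max_of_le_left (hbd j).2.1)
    (fun j => le_max_of_le_right <| by
      have h1 : ‖z (2 * j + 2)‖ = ‖z (2 * j + 1)‖ := by rw [hconj, RCLike.norm_conj]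
      rw [norm_mul, Complex.norm_real, Real.norm_eq_abs, hoff, h1]
      exact (hbd j).2.2)
  obtain ⟨B, hB, hBform⟩ := exists_jacobi_operator (diagB z ν) (fun j => (offB z ν j : ℂ))
    (max (K ^ 2) K)
    (fun j => le_max_of_le_left (by
      rw [abs_of_nonneg (zero_le_one.trans (hB1 j))]
      exact (hbd j).1))
    (fun j => le_max_of_le_right <| by
      rw [Complex.norm_real, Real.norm_eq_abs, hoff]
      refine Real.sqrt_le_iff.2 ⟨hK, ?_⟩
      have := (hbd j).1
      rw [diagB]
      linarith)
  rw [← matA_eq_jacobiMatrix hconj] at hA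
  rw [← matB_eq_jacobiMatrix] at hB
  have hpart : ∀ (y : SeqL2) (k : ℕ), (∀ i < k, y i = 0) →
      (inner ℂ y (B y)).im = 0 ∧ ‖y k‖ ^ 2 ≤ (inner ℂ y (B y)).re := by
    intro y k hy
    refine ⟨(hBform y).1, ge_of_tendsto (hBform y).2 ?_⟩
    filter_upwards [Filter.eventually_ge_atTop k] with N hN
    have := le_jacobiForm (d := diagB z ν) (c := fun j => (offB z ν j : ℂ)) (q := fun _ => 1)
      (fun _ => one_pos) (fun j => by
        rw [Complex.norm_real, Real.norm_eq_abs, sq_abs, offB_sq hle hz hν]; ring) hy hN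
    simpa using this
  refine ⟨A, B, hA, hB, hpart, ?_⟩
  rintro x ⟨y, hy0, hy⟩
  -- The lower bound of part 1 is used at the first nonzero coordinate of `y`.
  have hβ : 0 < (inner ℂ y (B y)).re := by
    have hex : ∃ j, y j ≠ 0 := by
      by_contra! h
      exact hy0 (lp.ext (funext h))
    classical
    refine lt_of_lt_of_le ?_ (hpart y (Nat.find hex) fun i hi => ?_).2
    · have := norm_pos_iff.2 (Nat.find_spec hex)
      positivity
    · exact not_not.1 (Nat.find_min hex hi)
  have hsign : ∀ t s : ℝ, t ∉ Set.Icc a b → (∀ r ∈ Set.Icc a b, 0 ≤ s * (1 / (t - r))) →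
      s ^ 2 = 1 → 0 ≤ s * (t * (inner ℂ y (B y)).re - (inner ℂ y (A y)).re) := by
    intro t s ht hs hs1
    refine ge_of_tendsto ((((hBform y).2.const_mul t).sub (hAform y).2).const_mul s) ?_
    exact Filter.Eventually.of_forall fun N =>
      jacobiForm_pencil_nonneg hle hconj hν (ofReal_notMem_complexIcc ht) hs hs1 y N
  have h1 : x * inner ℂ y (B y) = inner ℂ y (A y) := by
    have : (x • B - A) y = x • B y - A y := rfl
    rw [this, inner_sub_right, inner_smul_right] at hy
    exact sub_eq_zero.1 hy
  have eA : inner ℂ y (A y) = (((inner ℂ y (A y)).re : ℝ) : ℂ) :=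
    Complex.ext rfl (by simpa using (hAform y).1)
  have eB : inner ℂ y (B y) = (((inner ℂ y (B y)).re : ℝ) : ℂ) :=
    Complex.ext rfl (by simpa using (hBform y).1)
  -- Both forms are real, so `x` is their quotient; letting `t` tend to `a` from below and to `b`
  -- from above in `hsign` places it in `[a, b]`.
  refine ⟨(inner ℂ y (A y)).re / (inner ℂ y (B y)).re, ⟨?_, ?_⟩, ?_⟩
  · refine le_div_of_forall_lt_mul_le hβ fun t ht => ?_
    have := hsign t (-1) (fun h => by linarith [h.1]) (fun r hr => by
      rw [neg_one_mul, ← one_div_neg_eq_neg_one_div]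
      exact one_div_nonneg.2 (by linarith [hr.1])) (by norm_num)
    linarith
  · refine div_le_of_forall_lt_mul_le hβ fun t ht => ?_
    have := hsign t 1 (fun h => by linarith [h.2]) (fun r hr => by
      rw [one_mul]
      exact one_div_nonneg.2 (by linarith [hr.2])) (by norm_num)
    linarith
  · have hβ' : (((inner ℂ y (B y)).re : ℝ) : ℂ) ≠ 0 := by exact_mod_cast hβ.ne'
    simp only [Complex.ofReal_div]
    rw [div_eq_iff hβ', ← eA, ← eB, h1]
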